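/- **Setting.** Let $(\Omega,\mathcal A,P)$ be a probability space with a filtration $\{\mathcal F_t\}_{t\ge 1}$, let $k\ge 1$, $m,p\ge 0$ be integers, and let $Y_t\in\mathbf R^k$, $Z_t\in\mathbf R^m$, $\sigma_t^2=(\sigma_{1t}^2,\dots,\sigma_{pt}^2)^\intercal$, $t\ge1$, be $\mathcal F_t$-measurable, where $$\mathrm{Var}(Y_{t+1}\mid\mathcal F_t)=\Lambda D_t\Lambda^\intercal+\Omega_0,\qquad D_t=\mathrm{diag}(\sigma_{1t}^2,\dots,\sigma_{pt}^2),$$ for a constant $k\times p$ matrix $\Lambda$ and a constant positive semidefinite $k\times k$ matrix $\Omega_0$. Assume, for all $t$: (i) $\Lambda$ has full column rank; (ii) $\mathrm{Var}(\sigma_t^2)$ is nonsingular; (iii) $E[Y_{t+1}\mid\mathcal F_t]=0$; (iv) $\mathrm{Var}(Z_t)$ is nonsingular; (v) $\mathrm{Cov}(Z_t,\sigma_t^2)$ has full column rank $p$; (vi) $\{(Y_t,Z_t)\}$ is stationary and ergodic, $E\|Z_t\|^2<\infty$, $E\|Y_t\|^4<\infty$. Assume moreover that the stacked vector $W_t$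 of $Z_t$, $\mathrm{vec}(Y_{t+1}Y_{t+1}^\intercal)$ and $\mathrm{vec}(Y_{t+1}Y_{t+1}^\intercal)\otimes Z_t$ fulfils the CLT: $W_t$ is square integrable and $T^{-1/2}\sum_{t=1}^T(W_t-E[W_t])$ converges in law to a centred, possibly degenerate, Gaussian vector. **Notation.** Let $\mathbb S^k=\{\gamma\in\mathbf R^k:\|\gamma\|=1\}$, $c(\gamma)=E[(\gamma^\intercal Y_{t+1})^2]$, $\mu_z=E[Z_t]$, $\theta_0(\gamma)=E[Z_t\{(\gamma^\intercal Y_{t+1})^2-c(\gamma)\}]$, $\Gamma_0=\{\gamma\in\mathbb S^k:\theta_0(\gamma)=0\}$, $\hat c(\gamma)=\frac1T\sum_{t=1}^T(\gamma^\intercal Y_{t+1})^2$ and $\hat\theta_T(\gamma)=\frac1T\sum_{t=1}^T Z_t\{(\gamma^\intercal Y_{t+1})^2-\hat c(\gamma)\}$. Let $G$ be the $m\times k^2$ matrix with $j$th row $\mathrm{vec}(\Delta_j)^\intercal$, where $\Delta_j=E[Z_t^{(j)}(Y_{t+1}Y_{t+1}^\intercal-E[Y_{t+1}Y_{t+1}^\intercal])]$.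 **Proposition.** Suppose that $\mathrm H_0:\ \inf_{\gamma\in\mathbb S^k}\|\theta_0(\gamma)\|^2=0$ holds. Then there is a zero mean Gaussian process $\mathbb G$ on $\mathbb S^k$ with values in $\mathbf R^m$ and continuous paths such that $\sqrt T\{\hat\theta_T-\theta_0\}\to\mathbb G$ in law with respect to uniform convergence on $\mathbb S^k$, with $$E[\mathbb G(\gamma_1)\mathbb G(\gamma_2)^\intercal]=E\big[(Z_t-\mu_z)(Z_t-\mu_z)^\intercal\{(\gamma_1^\intercal Y_{t+1})^2-c(\gamma_1)\}\{(\gamma_2^\intercal Y_{t+1})^2-c(\gamma_2)\}\big]\quad\text{for }\gamma_1,\gamma_2\in\Gamma_0,$$ and $$T\min_{\gamma\in\mathbb S^k}\|\hat\theta_T(\gamma)\|^2\ \xrightarrow{\ L\ }\ \min_{\gamma_0\in\Gamma_0}\min_{v\in\mathbf R^k}\|\mathbb G(\gamma_0)+G\,\mathrm{vec}(vv^\intercal)\|^2 ,$$ where all the minima are attained. -/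

import Mathlib

open MeasureTheory ProbabilityTheory Filter Topology

noncomputable section

namespace CommonCH

/-- `ℝ^n` with the Euclidean norm. -/
abbrev E (n : ℕ) : Type := EuclideanSpace ℝ (Fin n)

/-- The unit sphere `S^k = {γ ∈ ℝ^k : ‖γ‖ = 1}`. -/
abbrev USphere (k : ℕ) : Type := Metric.sphere (0 : E k) 1

/-- The space of continuous maps `S^k → ℝ^m` with the supremum norm. -/
abbrev PathSpace (k m : ℕ) : Type := C(USphere k, E m)

/-- The path space carries its Borel σ-algebra. -/
instance instMeasurableSpacePathSpace (k m : ℕ) : MeasurableSpace (PathSpace k m) :=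
  borel (PathSpace k m)

instance instBorelSpacePathSpace (k m : ℕ) : BorelSpace (PathSpace k m) := ⟨rfl⟩

section General

variable {Ω : Type*} {mΩ : MeasurableSpace Ω}

/-- The process `X` is (strictly) stationary and ergodic: the shift on the sequence space is
measure preserving and ergodic for the law of the whole process. -/
def StationaryErgodic {S : Type*} [MeasurableSpace S] (X : ℕ → Ω → S) (P : Measure Ω) : Prop :=
  Ergodic (fun (x : ℕ → S) (t : ℕ) => x (t + 1)) (P.map (fun ω t => X t ω))

/-- The `p × q` matrix `Cov(X, W) = E[(X - E X)(W - E W)ᵀ]`. -/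
def crossCov {p q : ℕ} (X : Ω → Fin p → ℝ) (W : Ω → Fin q → ℝ) (P : Measure Ω) :
    Matrix (Fin p) (Fin q) ℝ :=
  Matrix.of fun i j => cov[fun ω => X ω i, fun ω => W ω j; P]

/-- The conditional covariance matrix `Var(X | 𝒢) = E[(X - E[X|𝒢])(X - E[X|𝒢])ᵀ | 𝒢]`. -/
def condCovMatrix {k : ℕ} (P : Measure Ω) (X : Ω → E k) (𝒢 : MeasurableSpace Ω) (ω : Ω) :
    Matrix (Fin k) (Fin k) ℝ :=
  Matrix.of fun i j =>
    (P[fun ω' => (X ω' i - (P[X | 𝒢]) ω' i) * (X ω' j - (P[X | 𝒢]) ω' j) | 𝒢]) ω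

/-- The sequence `W` of random vectors fulfils the central limit theorem: its terms are square
integrable and `T^{-1/2} ∑_{t < T} (W_t - E W_t)` converges in distribution to a centred
(possibly degenerate) Gaussian vector. -/
def FulfilsCLT {ι : Type} [Fintype ι] (W : ℕ → Ω → EuclideanSpace ℝ ι) (P : Measure Ω)
    [IsProbabilityMeasure P] : Prop :=
  (∀ t, MemLp (W t) 2 P) ∧
    ∃ (N : Measure (EuclideanSpace ℝ ι)) (_ : IsGaussian N), ∫ x, x ∂N = 0 ∧
      TendstoInDistribution
        (fun (T : ℕ) ω => (Real.sqrt T)⁻¹ • ∑ t ∈ Finset.range T, (W t ω - ∫ ω', W t ω' ∂P))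
        atTop (fun x => x) (fun _ => P) N

end General

section Model

variable {Ω : Type*} {mΩ : MeasurableSpace Ω} {k m p : ℕ}

/-- The conditionally heteroskedastic factor model. Time starts at `0`, so that index `t` here is
date `t + 1` when dates are counted from one. The `k`-dimensional series is `Y`, the
`m`-dimensional instruments are `Z`, the factor variances are `(σ t ω j)^2`, and
`Var(Y_{t+1} | ℱ_t) = Λ D_t Λᵀ + Om` with `D_t = diag((σ t j)^2)`. -/
structure Model (P : Measure Ω) (ℱ : Filtration ℕ mΩ) (Y : ℕ → Ω → E k) (Z : ℕ → Ω → E m)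
    (Λ : Matrix (Fin k) (Fin p) ℝ) (σ : ℕ → Ω → Fin p → ℝ) (Om : Matrix (Fin k) (Fin k) ℝ) :
    Prop where
  adapted_Y : ∀ t, Measurable[ℱ t] (Y t)
  adapted_sq : ∀ t j, Measurable[ℱ t] (fun ω => σ t ω j ^ 2)
  posSemidef : Om.PosSemidef
  condVar_eq : ∀ t, condCovMatrix P (Y (t + 1)) (ℱ t) =ᵐ[P]
    fun ω => Λ * Matrix.diagonal (fun j => σ t ω j ^ 2) * Λ.transpose + Om
  /-- (i) `Λ` has full column rank. -/
  fullRank : Λ.rank = p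
  /-- (ii) `Var(σ_t²)` is nonsingular. -/
  var_sq : ∀ t, IsUnit (crossCov (fun ω j => σ t ω j ^ 2) (fun ω j => σ t ω j ^ 2) P).det
  /-- (iii) `E[Y_{t+1} | ℱ_t] = 0`. -/
  condMean : ∀ t, P[Y (t + 1) | ℱ t] =ᵐ[P] 0
  /-- (iv) `Z_t` is `ℱ_t`-measurable with nonsingular variance. -/
  adapted_Z : ∀ t, Measurable[ℱ t] (Z t)
  var_Z : ∀ t, IsUnit (crossCov (fun ω => (Z t ω).ofLp) (fun ω => (Z t ω).ofLp) P).det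
  /-- (v) `Cov(Z_t, σ_t²)` has full column rank `p`. -/
  cov_Z_sq : ∀ t, (crossCov (fun ω => (Z t ω).ofLp) (fun ω j => σ t ω j ^ 2) P).rank = p
  /-- (vi) `(Y_t, Z_t)` is stationary and ergodic, `E‖Z_t‖² < ∞` and `E‖Y_t‖⁴ < ∞`. -/
  stationaryErgodic : StationaryErgodic (fun t ω => (Y t ω, Z t ω)) P
  memLp_Z : ∀ t, MemLp (Z t) 2 P
  memLp_Y : ∀ t, MemLp (Y t) 4 P

/-- The outer product `v vᵀ`. -/
def outer (v : E k) : Matrix (Fin k) (Fin k) ℝ := Matrix.vecMulVec v.ofLp v.ofLp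

/-- `Z_t`, `vec(Y_{t+1} Y_{t+1}ᵀ)` and `vec(Y_{t+1} Y_{t+1}ᵀ) ⊗ Z_t`, stacked into one vector. -/
def stacked (Y : ℕ → Ω → E k) (Z : ℕ → Ω → E m) (t : ℕ) (ω : Ω) :
    EuclideanSpace ℝ (Fin m ⊕ (Fin k × Fin k) ⊕ ((Fin k × Fin k) × Fin m)) :=
  WithLp.toLp 2 <| Sum.elim (fun i => Z t ω i) <|
    Sum.elim (fun a => (outer (Y (t + 1) ω)).vec a)
      (fun a => (outer (Y (t + 1) ω)).vec a.1 * Z t ω a.2)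

/-- `c(γ) = E[(γᵀ Y_{t+1})²]`, which does not depend on `t` under stationarity; likewise below. -/
def c (P : Measure Ω) (Y : ℕ → Ω → E k) (γ : E k) : ℝ := ∫ ω, (inner ℝ γ (Y 1 ω)) ^ 2 ∂P

/-- `θ₀(γ) = E[Z_t {(γᵀ Y_{t+1})² - c(γ)}]`. -/
def theta0 (P : Measure Ω) (Y : ℕ → Ω → E k) (Z : ℕ → Ω → E m) (γ : USphere k) : E m :=
  ∫ ω, ((inner ℝ (γ : E k) (Y 1 ω)) ^ 2 - c P Y γ) • Z 0 ω ∂P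

/-- `ĉ(γ) = T⁻¹ ∑_t (γᵀ Y_{t+1})²`, the sum over the first `T` dates. -/
def cHat (Y : ℕ → Ω → E k) (T : ℕ) (ω : Ω) (γ : E k) : ℝ :=
  (T : ℝ)⁻¹ * ∑ t ∈ Finset.range T, (inner ℝ γ (Y (t + 1) ω)) ^ 2

/-- `θ̂_T(γ) = T⁻¹ ∑_t Z_t {(γᵀ Y_{t+1})² - ĉ(γ)}`, a continuous function of `γ ∈ S^k`. -/
def thetaHat (Y : ℕ → Ω → E k) (Z : ℕ → Ω → E m) (T : ℕ) (ω : Ω) : PathSpace k m where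
  toFun γ := (T : ℝ)⁻¹ •
    ∑ t ∈ Finset.range T, ((inner ℝ (γ : E k) (Y (t + 1) ω)) ^ 2 - cHat Y T ω γ) • Z t ω
  continuous_toFun := by
    unfold cHat
    fun_prop

/-- `φ(θ) = inf_{γ ∈ S^k} ‖θ(γ)‖²`. -/
def phi (θ : USphere k → E m) : ℝ := ⨅ γ : USphere k, ‖θ γ‖ ^ 2

/-- The identified set `Γ₀ = {γ₀ ∈ S^k : θ₀(γ₀) = 0}`. -/
def Gamma0 (P : Measure Ω) (Y : ℕ → Ω → E k) (Z : ℕ → Ω → E m) : Set (USphere k) :=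
  {γ | theta0 P Y Z γ = 0}

/-- `Δ_j = E[Z_t^{(j)} (Y_{t+1} Y_{t+1}ᵀ - E[Y_{t+1} Y_{t+1}ᵀ])]`. -/
def Delta (P : Measure Ω) (Y : ℕ → Ω → E k) (Z : ℕ → Ω → E m) (j : Fin m) :
    Matrix (Fin k) (Fin k) ℝ :=
  Matrix.of fun a b =>
    ∫ ω, Z 0 ω j * (outer (Y 1 ω) a b - ∫ ω', outer (Y 1 ω') a b ∂P) ∂P

/-- The `m × k²` matrix `G` whose `j`-th row is `vec(Δ_j)ᵀ`. -/
def Gmat (P : Measure Ω) (Y : ℕ → Ω → E k) (Z : ℕ → Ω → E m) :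
    Matrix (Fin m) (Fin k × Fin k) ℝ :=
  Matrix.of fun j => (Delta P Y Z j).vec

/-- `‖x + G vec(v vᵀ)‖²`. -/
def shifted (P : Measure Ω) (Y : ℕ → Ω → E k) (Z : ℕ → Ω → E m) (x : E m) (v : E k) : ℝ :=
  ‖x + WithLp.toLp 2 ((Gmat P Y Z).mulVec (outer v).vec)‖ ^ 2

/-- `inf_{v ∈ ℝ^k} ‖x + G vec(v vᵀ)‖²`. -/
def innerMin (P : Measure Ω) (Y : ℕ → Ω → E k) (Z : ℕ → Ω → E m) (x : E m) : ℝ :=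
  ⨅ v : E k, shifted P Y Z x v

/-- `inf_{γ₀ ∈ Γ₀} inf_{v ∈ ℝ^k} ‖h(γ₀) + G vec(v vᵀ)‖²`. -/
def limitFunctional (P : Measure Ω) (Y : ℕ → Ω → E k) (Z : ℕ → Ω → E m) (h : PathSpace k m) : ℝ :=
  ⨅ γ₀ : Gamma0 P Y Z, innerMin P Y Z (h γ₀)

/-- The `(i, j)` entry of
`E[(Z_t - μ_z)(Z_t - μ_z)ᵀ {(γ₁ᵀ Y_{t+1})² - c(γ₁)} {(γ₂ᵀ Y_{t+1})² - c(γ₂)}]`. -/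
def covFunctional (P : Measure Ω) (Y : ℕ → Ω → E k) (Z : ℕ → Ω → E m) (γ₁ γ₂ : USphere k)
    (i j : Fin m) : ℝ :=
  ∫ ω, (Z 0 ω i - ∫ ω', Z 0 ω' i ∂P) * (Z 0 ω j - ∫ ω', Z 0 ω' j ∂P) *
    ((inner ℝ (γ₁ : E k) (Y 1 ω)) ^ 2 - c P Y γ₁) *
    ((inner ℝ (γ₂ : E k) (Y 1 ω)) ^ 2 - c P Y γ₂) ∂P

/-- `ν` is the law on the path space of the limit process `𝔾` of the estimator: a zero mean
Gaussian process with covariance `covFunctional` on the identified set, such that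
`√T (θ̂_T - θ₀)` converges weakly to it in the uniform norm. The function `θ₀` is required to be
continuous and is viewed as an element of the path space. -/
def IsEstimatorLimit (P : Measure Ω) [IsProbabilityMeasure P] (Y : ℕ → Ω → E k)
    (Z : ℕ → Ω → E m) (ν : Measure (PathSpace k m)) [IsProbabilityMeasure ν] : Prop :=
  IsGaussianProcess (fun (γ : USphere k) (h : PathSpace k m) => h γ) ν ∧
  (∀ (γ : USphere k) (i : Fin m), ∫ h : PathSpace k m, h γ i ∂ν = 0) ∧
  (∀ γ₁ ∈ Gamma0 P Y Z, ∀ γ₂ ∈ Gamma0 P Y Z, ∀ i j : Fin m,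
    ∫ h : PathSpace k m, h γ₁ i * h γ₂ j ∂ν = covFunctional P Y Z γ₁ γ₂ i j) ∧
  ∃ θ₀ : PathSpace k m, (∀ γ, θ₀ γ = theta0 P Y Z γ) ∧
    TendstoInDistribution (fun (T : ℕ) ω => Real.sqrt T • (thetaHat Y Z T ω - θ₀))
      atTop (fun h => h) (fun _ => P) ν

end Model

end CommonCH

end

open MeasureTheory ProbabilityTheory Filter Topology

noncomputable section

/-! Write `Q v = G vec(v vᵀ)` (`gForm`) and let `N` be the kernel of `Λᵀ` (`loadingKernel`).
Conditioning on `ℱ_0` gives `Q v = Cov(Z, σ²) ((Λᵀ v)_j²)_j`. Since the covariance has full column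
rank, `Q` vanishes exactly on `N`, and it depends on `v` only through the projection to `Nᗮ`
(`Model.isQuadraticModulo`). On the sphere `θ₀ = Q`, so `Γ₀` is the unit sphere of `N`.

Put `r = T^{-1/4}` and `h = √T (θ̂_T - θ₀)`. Then `T ‖θ̂_T(γ)‖² = ‖h γ + r⁻² Q γ‖²`, and `r⁻² Q γ =
Q v`, where `v` is the `Nᗮ`-component of `γ` divided by `r`. The statistic is therefore `fiberMin`
at `(r, h)`: the minimum over pairs `(γ, v)` such that the `Nᗮ`-component of `γ` is `r v`. At `r =
0` the constraint says `γ ∈ N` and leaves `v` free in `Nᗮ`, which is the limit functional. As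
`fiberMin` is jointly continuous in `(r, h)` (`continuous_fiberMin`), no expansion around a
minimiser is needed. The error `h` is itself an exact continuous function of `r` and the normalized
sum in the CLT (`Model.error_eq_expansion`), so both limits follow from the continuous mapping
theorem.

The CLT does not identify the limiting covariance, because convergence in law need not carry second
moments. On `Γ₀` the linear part of the error is a normalized sum of stationary martingale
differences, and truncation with a fourth moment bound keeps second moments from escaping
(`IsMartingaleDifference.integral_sq_limit`). Polarization then gives the covariances. -/

namespace CommonCH

/-! ### Minimising a norm plus a degenerate quadratic map. -/

section FormMinimum

variable {V F : Type*} [NormedAddCommGroup V] [InnerProductSpace ℝ V] [FiniteDimensional ℝ V]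
  [NormedAddCommGroup F] [NormedSpace ℝ F]

/-- `Q` is a continuous map, homogeneous of degree two, which factors through the quotient by the
subspace `N` and vanishes only on `N`. -/
structure IsQuadraticModulo (N : Submodule ℝ V) (Q : V → F) : Prop where
  continuous : Continuous Q
  map_smul : ∀ (r : ℝ) (v : V), Q (r • v) = r ^ 2 • Q v
  map_add : ∀ a ∈ N, ∀ v, Q (a + v) = Q v
  mem_of_map_eq_zero : ∀ v, Q v = 0 → v ∈ N

variable {N : Submodule ℝ V} {Q : V → F}

lemma sub_starProjection_orthogonal_mem (N : Submodule ℝ V) (v : V) :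
    v - Nᗮ.starProjection v ∈ N := by
  have h := Submodule.sub_starProjection_mem_orthogonal (K := Nᗮ) v
  rwa [Submodule.orthogonal_orthogonal] at h

namespace IsQuadraticModulo

omit [FiniteDimensional ℝ V] in
lemma map_zero (hQ : IsQuadraticModulo N Q) : Q 0 = 0 := by
  simpa using hQ.map_smul 0 0

omit [FiniteDimensional ℝ V] in
lemma map_eq_zero_iff (hQ : IsQuadraticModulo N Q) {v : V} : Q v = 0 ↔ v ∈ N := by
  refine ⟨hQ.mem_of_map_eq_zero v, fun hv => ?_⟩
  have := hQ.map_add v hv 0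
  rwa [add_zero, hQ.map_zero] at this

lemma map_starProjection (hQ : IsQuadraticModulo N Q) (v : V) :
    Q (Nᗮ.starProjection v) = Q v := by
  have := hQ.map_add _ (sub_starProjection_orthogonal_mem N v) (Nᗮ.starProjection v)
  rw [sub_add_cancel] at this
  exact this.symm

/-- On the compact unit sphere of `Nᗮ` the map has no zero, and homogeneity extends the resulting
lower bound to all of `Nᗮ`. -/
lemma exists_le_norm (hQ : IsQuadraticModulo N Q) :
    ∃ c > 0, ∀ v ∈ Nᗮ, c * ‖v‖ ^ 2 ≤ ‖Q v‖ := by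
  let K : Set V := Metric.sphere 0 1 ∩ (Nᗮ : Set V)
  have hK : IsCompact K :=
    (isCompact_sphere (0 : V) 1).inter_right (Submodule.closed_of_finiteDimensional _)
  have key : ∃ c > 0, ∀ v ∈ K, c ≤ ‖Q v‖ := by
    rcases K.eq_empty_or_nonempty with h | h
    · exact ⟨1, one_pos, by simp [h]⟩
    · obtain ⟨x, hx, hmin⟩ := hK.exists_isMinOn h hQ.continuous.norm.continuousOn
      refine ⟨‖Q x‖, norm_pos_iff.2 fun h0 => ?_, fun v hv => hmin hv⟩
      have h1 : x ∈ N := hQ.mem_of_map_eq_zero x h0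
      have h2 : inner ℝ x x = 0 := Submodule.inner_right_of_mem_orthogonal h1 hx.2
      have h3 : ‖x‖ = 1 := by simpa using hx.1
      rw [inner_self_eq_zero.1 h2] at h3
      simp at h3
  obtain ⟨c, hc, hcK⟩ := key
  refine ⟨c, hc, fun v hv => ?_⟩
  by_cases hv0 : v = 0
  · simp [hv0]
  have hn : 0 < ‖v‖ := norm_pos_iff.2 hv0
  have h1 := hcK (‖v‖⁻¹ • v) ⟨by simp [norm_smul, hn.ne'], Nᗮ.smul_mem _ hv⟩
  rw [hQ.map_smul, norm_smul] at h1
  have h2 : ‖(‖v‖⁻¹ ^ 2 : ℝ)‖ = (‖v‖ ^ 2)⁻¹ := by simp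
  rw [h2, ← div_eq_inv_mul, le_div_iff₀ (by positivity)] at h1
  exact h1

/-- Coercivity on `Nᗮ`, uniform over bounded `x`. The uniformity is what lets `h` vary in the
continuity proof. -/
lemma exists_norm_le (hQ : IsQuadraticModulo N Q) (B a : ℝ) :
    ∃ R : ℝ, ∀ v ∈ Nᗮ, ∀ x : F, ‖x‖ ≤ B → ‖x + Q v‖ ^ 2 ≤ a → ‖v‖ ≤ R := by
  obtain ⟨c, hc, h⟩ := hQ.exists_le_norm
  refine ⟨√((B + √a) / c), fun v hv x hx hxa => Real.le_sqrt_of_sq_le ?_⟩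
  rw [le_div_iff₀ hc, mul_comm]
  refine (h v hv).trans ?_
  have h1 : ‖Q v‖ ≤ ‖x‖ + ‖x + Q v‖ := by
    have := norm_sub_le (x + Q v) x
    rw [add_sub_cancel_left] at this
    linarith
  have h2 := Real.le_sqrt_of_sq_le hxa
  linarith

end IsQuadraticModulo

/-- The pairs of a point `γ` of the unit sphere and a vector `v ⟂ N` such that the component of `γ`
orthogonal to `N` is `r • v`. -/
def scaledFiber (N : Submodule ℝ V) (r : ℝ) : Set (Metric.sphere (0 : V) 1 × V) :=
  {x | x.2 ∈ Nᗮ ∧ Nᗮ.starProjection (x.1 : V) = r • x.2}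

/-- The infimum of `‖h γ + Q v‖²` over the pairs `(γ, v)` in `scaledFiber N r`. -/
def fiberMin (N : Submodule ℝ V) (Q : V → F) (x : ℝ × C(Metric.sphere (0 : V) 1, F)) : ℝ :=
  sInf ((fun y : Metric.sphere (0 : V) 1 × V => ‖x.2 y.1 + Q y.2‖ ^ 2) '' scaledFiber N x.1)

lemma mk_zero_mem_scaledFiber {γ₀ : Metric.sphere (0 : V) 1} (hγ₀ : (γ₀ : V) ∈ N) (r : ℝ) :
    (γ₀, (0 : V)) ∈ scaledFiber N r := by
  refine ⟨Nᗮ.zero_mem, ?_⟩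
  simp only [smul_zero]
  rw [Submodule.starProjection_apply_eq_zero_iff, Submodule.orthogonal_orthogonal]
  exact hγ₀

omit [NormedSpace ℝ F] in
lemma fiberMin_le (N : Submodule ℝ V) (Q : V → F) (r : ℝ)
    (h : C(Metric.sphere (0 : V) 1, F)) {y : Metric.sphere (0 : V) 1 × V}
    (hy : y ∈ scaledFiber N r) : fiberMin N Q (r, h) ≤ ‖h y.1 + Q y.2‖ ^ 2 :=
  csInf_le ⟨0, by rintro _ ⟨z, -, rfl⟩; positivity⟩ ⟨y, hy, rfl⟩

/-- Closedness is joint in `(r, h, γ, v)`: slices at fixed `(r, h)` give existence of minimisers,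
and the joint form passes to the limit along sequences. -/
lemma isClosed_scaledFiber_le (hQ : IsQuadraticModulo N Q) (a : ℝ) :
    IsClosed {z : (ℝ × C(Metric.sphere (0 : V) 1, F)) × (Metric.sphere (0 : V) 1 × V) |
      z.2 ∈ scaledFiber N z.1.1 ∧ ‖z.1.2 z.2.1 + Q z.2.2‖ ^ 2 ≤ a} := by
  have hQc := hQ.continuous
  have h1 : IsClosed {z : (ℝ × C(Metric.sphere (0 : V) 1, F)) × (Metric.sphere (0 : V) 1 × V) |
      z.2.2 ∈ Nᗮ} :=
    (Submodule.closed_of_finiteDimensional Nᗮ).preimage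
      (f := fun z : (ℝ × C(Metric.sphere (0 : V) 1, F)) × (Metric.sphere (0 : V) 1 × V) => z.2.2)
      (by fun_prop)
  have h2 : IsClosed {z : (ℝ × C(Metric.sphere (0 : V) 1, F)) × (Metric.sphere (0 : V) 1 × V) |
      Nᗮ.starProjection (z.2.1 : V) = z.1.1 • z.2.2} :=
    isClosed_eq (by fun_prop) (by fun_prop)
  have h3 : IsClosed {z : (ℝ × C(Metric.sphere (0 : V) 1, F)) × (Metric.sphere (0 : V) 1 × V) |
      ‖z.1.2 z.2.1 + Q z.2.2‖ ^ 2 ≤ a} :=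
    isClosed_le (by fun_prop) (by fun_prop)
  exact (h1.inter h2).inter h3

lemma exists_isMinOn_scaledFiber (hQ : IsQuadraticModulo N Q)
    (hN : ∃ γ₀ : Metric.sphere (0 : V) 1, (γ₀ : V) ∈ N)
    (x : ℝ × C(Metric.sphere (0 : V) 1, F)) :
    ∃ y ∈ scaledFiber N x.1, ‖x.2 y.1 + Q y.2‖ ^ 2 = fiberMin N Q x ∧
      ∀ z ∈ scaledFiber N x.1, ‖x.2 y.1 + Q y.2‖ ^ 2 ≤ ‖x.2 z.1 + Q z.2‖ ^ 2 := by
  obtain ⟨γ₀, hγ₀⟩ := hN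
  have hQc := hQ.continuous
  obtain ⟨r, h⟩ := x
  let f : Metric.sphere (0 : V) 1 × V → ℝ := fun y => ‖h y.1 + Q y.2‖ ^ 2
  -- This pair is feasible for every `r`, so sublevel sets at its value are nonempty and only they
  -- need to be compact.
  let y₀ : Metric.sphere (0 : V) 1 × V := (γ₀, 0)
  have hy₀ : y₀ ∈ scaledFiber N r := mk_zero_mem_scaledFiber hγ₀ r
  let K : Set (Metric.sphere (0 : V) 1 × V) := {y | y ∈ scaledFiber N r ∧ f y ≤ f y₀}
  have hKc : IsClosed K :=
    (isClosed_scaledFiber_le hQ (f y₀)).preimage (f := fun y => ((r, h), y)) (by fun_prop)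
  obtain ⟨R, hR⟩ := hQ.exists_norm_le ‖h‖ (f y₀)
  have hK : IsCompact K := by
    refine (isCompact_univ.prod (isCompact_closedBall (0 : V) R)).of_isClosed_subset hKc ?_
    intro y hy
    exact ⟨trivial, by simpa using hR y.2 hy.1.1 (h y.1) (h.norm_coe_le_norm _) hy.2⟩
  have hf : Continuous f := by fun_prop
  obtain ⟨y, hy, hmin⟩ := hK.exists_isMinOn ⟨y₀, hy₀, le_rfl⟩ hf.continuousOn
  have hall : ∀ z ∈ scaledFiber N r, f y ≤ f z := by
    intro z hz
    by_cases hzy : f z ≤ f y₀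
    · exact hmin (show z ∈ K from ⟨hz, hzy⟩)
    · exact hy.2.trans (not_le.1 hzy).le
  refine ⟨y, hy.1, ?_, hall⟩
  refine (IsLeast.csInf_eq (a := f y) ⟨Set.mem_image_of_mem _ hy.1, ?_⟩).symm
  rintro _ ⟨z, hz, rfl⟩
  exact hall z hz

open Classical in
-- The delicate point is `r = 0`, where the feasible set changes shape: the lower bound comes from
-- coercivity, the upper bound from moving a minimiser into nearby fibers.
lemma continuous_fiberMin (hQ : IsQuadraticModulo N Q)
    (hN : ∃ γ₀ : Metric.sphere (0 : V) 1, (γ₀ : V) ∈ N) :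
    Continuous (fiberMin N Q) := by
  have hQc := hQ.continuous
  rw [continuous_iff_lower_upperSemicontinuous]
  constructor
  -- Minimisers along a convergent sequence stay in a compact set by coercivity, and a cluster point
  -- is feasible for the limit.
  · rw [lowerSemicontinuous_iff_isClosed_preimage]
    intro a
    refine IsSeqClosed.isClosed fun x x₀ hx hlim => ?_
    choose y hy hyx _ using fun n => exists_isMinOn_scaledFiber hQ hN (x n)
    obtain ⟨B, hB⟩ := (Metric.isBounded_range_of_tendsto _ hlim).exists_norm_le
    obtain ⟨R, hR⟩ := hQ.exists_norm_le B a
    have hmem : ∀ n, y n ∈ (Set.univ : Set (Metric.sphere (0 : V) 1)) ×ˢ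
        Metric.closedBall (0 : V) R := by
      intro n
      refine ⟨trivial, ?_⟩
      have h1 : ‖(x n).2‖ ≤ B := (norm_snd_le (x n)).trans (hB _ ⟨n, rfl⟩)
      simpa using hR (y n).2 (hy n).1 _ (((x n).2.norm_coe_le_norm _).trans h1)
        ((hyx n).trans_le (hx n))
    obtain ⟨y₀, -, φ, hφ, hyφ⟩ :=
      (isCompact_univ.prod (isCompact_closedBall (0 : V) R)).tendsto_subseq hmem
    have hcl := (isClosed_scaledFiber_le hQ a).mem_of_tendsto
      ((hlim.comp hφ.tendsto_atTop).prodMk_nhds hyφ)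
      (Eventually.of_forall fun n => ⟨hy (φ n), (hyx (φ n)).trans_le (hx (φ n))⟩)
    exact (fiberMin_le N Q _ _ hcl.1).trans hcl.2
  · intro x₀ a ha
    obtain ⟨⟨γ, v⟩, ⟨hv, hγv⟩, hy, -⟩ := exists_isMinOn_scaledFiber hQ hN x₀
    rw [← hy] at ha
    simp only at hv hγv ha
    -- Keep the `N`-component of the minimiser `γ` and reset its `Nᗮ`-component to `r • v`. This
    -- returns `γ` at the base point and leaves the sphere only slightly nearby.
    let u : ℝ → V := fun r => (γ : V) - Nᗮ.starProjection (γ : V) + r • v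
    have hu₀ : u x₀.1 = γ := by simp [u, hγv]
    have hγ1 : ‖(γ : V)‖ = 1 := by simp
    have hu0 : ∀ᶠ x : ℝ × C(Metric.sphere (0 : V) 1, F) in 𝓝 x₀, u x.1 ≠ 0 := by
      have hc : Continuous fun x : ℝ × C(Metric.sphere (0 : V) 1, F) => u x.1 := by fun_prop
      refine hc.continuousAt.eventually_ne ?_
      rw [hu₀, ← norm_pos_iff, hγ1]
      exact one_pos
    -- The value at `u r = 0` plays no role, since `u` is nonzero near the base point.
    let g : ℝ → Metric.sphere (0 : V) 1 := fun r =>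
      if hr : u r = 0 then γ else ⟨‖u r‖⁻¹ • u r, by simp [norm_smul, hr]⟩
    have hg : ∀ r, u r ≠ 0 → (g r : V) = ‖u r‖⁻¹ • u r := fun r hr => by simp [g, hr]
    have hgx₀ : g x₀.1 = γ := by
      have : u x₀.1 ≠ 0 := by
        rw [hu₀, ← norm_pos_iff, hγ1]
        exact one_pos
      apply Subtype.ext
      rw [hg _ this, hu₀, hγ1]
      simp
    have hgt : Tendsto (fun x : ℝ × C(Metric.sphere (0 : V) 1, F) => g x.1) (𝓝 x₀) (𝓝 γ) := by
      rw [tendsto_subtype_rng]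
      have hc : ContinuousAt (fun x : ℝ × C(Metric.sphere (0 : V) 1, F) => ‖u x.1‖⁻¹ • u x.1)
          x₀ := by
        have : ‖u x₀.1‖ ≠ 0 := by rw [hu₀, hγ1]; exact one_ne_zero
        fun_prop (disch := assumption)
      have h1 : Tendsto (fun x : ℝ × C(Metric.sphere (0 : V) 1, F) => ‖u x.1‖⁻¹ • u x.1)
          (𝓝 x₀) (𝓝 (γ : V)) := by
        have h2 := hc.tendsto
        rw [hu₀, hγ1] at h2
        simpa using h2
      exact h1.congr' (hu0.mono fun x hx => (hg _ hx).symm)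
    -- Normalising `u` scales its `Nᗮ`-component as well, so `v` is divided by the same norm, which
    -- tends to one.
    have hmem : ∀ᶠ x : ℝ × C(Metric.sphere (0 : V) 1, F) in 𝓝 x₀,
        (g x.1, ‖u x.1‖⁻¹ • v) ∈ scaledFiber N x.1 := by
      filter_upwards [hu0] with x hx
      refine ⟨Nᗮ.smul_mem _ hv, ?_⟩
      simp only [hg _ hx, map_smul]
      rw [smul_comm]
      congr 1
      have h1 : Nᗮ.starProjection ((γ : V) - Nᗮ.starProjection (γ : V)) = 0 := by
        rw [Submodule.starProjection_apply_eq_zero_iff, Submodule.orthogonal_orthogonal]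
        exact sub_starProjection_orthogonal_mem N _
      simp only [u, map_add, h1, zero_add, map_smul]
      rw [Submodule.starProjection_eq_self_iff.2 hv]
    have hlim : Tendsto (fun x : ℝ × C(Metric.sphere (0 : V) 1, F) =>
        ‖x.2 (g x.1) + Q (‖u x.1‖⁻¹ • v)‖ ^ 2) (𝓝 x₀) (𝓝 (‖x₀.2 γ + Q v‖ ^ 2)) := by
      have h1 : Tendsto (fun x : ℝ × C(Metric.sphere (0 : V) 1, F) => x.2 (g x.1)) (𝓝 x₀)
          (𝓝 (x₀.2 γ)) := by
        have hc : Continuous fun z : C(Metric.sphere (0 : V) 1, F) × Metric.sphere (0 : V) 1 =>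
          z.1 z.2 := by fun_prop
        exact (hc.tendsto (x₀.2, γ)).comp (((continuous_snd.tendsto x₀)).prodMk_nhds hgt)
      have h2 : Tendsto (fun x : ℝ × C(Metric.sphere (0 : V) 1, F) => Q (‖u x.1‖⁻¹ • v)) (𝓝 x₀)
          (𝓝 (Q v)) := by
        have hne : ‖u x₀.1‖ ≠ 0 := by rw [hu₀, hγ1]; exact one_ne_zero
        have hc : ContinuousAt (fun x : ℝ × C(Metric.sphere (0 : V) 1, F) => ‖u x.1‖⁻¹ • v)
            x₀ := by
          fun_prop (disch := assumption)
        have h3 := (hQc.tendsto _).comp hc.tendsto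
        rw [hu₀, hγ1] at h3
        simpa [Function.comp_def] using h3
      exact ((h1.add h2).norm).pow 2
    filter_upwards [hmem, hlim.eventually_lt_const ha] with x hx1 hx2
    exact (fiberMin_le N Q x.1 x.2 hx1).trans_lt hx2

/-- For `r ≠ 0` the constraint determines `v` from `γ`, and homogeneity turns `Q v` into `r⁻² Q γ`.
-/
lemma fiberMin_of_ne_zero (hQ : IsQuadraticModulo N Q) {r : ℝ} (hr : r ≠ 0)
    (h : C(Metric.sphere (0 : V) 1, F)) :
    fiberMin N Q (r, h) = ⨅ γ : Metric.sphere (0 : V) 1, ‖h γ + (r ^ 2)⁻¹ • Q γ‖ ^ 2 := by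
  have hval : ∀ y ∈ scaledFiber N r, Q y.2 = (r ^ 2)⁻¹ • Q y.1 := by
    rintro ⟨γ, v⟩ ⟨-, hγ⟩
    simp only at hγ
    rw [← hQ.map_starProjection (γ : V), hγ, hQ.map_smul, smul_smul,
      inv_mul_cancel₀ (pow_ne_zero 2 hr), one_smul]
  unfold fiberMin iInf
  congr 1
  ext a
  constructor
  · rintro ⟨y, hy, rfl⟩
    exact ⟨y.1, by simp only [hval y hy]⟩
  · rintro ⟨γ, rfl⟩
    have hy : (γ, r⁻¹ • Nᗮ.starProjection (γ : V)) ∈ scaledFiber N r := by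
      refine ⟨Nᗮ.smul_mem _ (Submodule.starProjection_apply_mem _ _), ?_⟩
      simp only
      rw [smul_smul, mul_inv_cancel₀ hr, one_smul]
    exact ⟨_, hy, by simp only [hval _ hy]⟩

/-- Projecting to `Nᗮ` does not change `Q`, so the search reduces to `Nᗮ`, where sublevel sets are
compact. -/
lemma exists_isMin_norm_add (hQ : IsQuadraticModulo N Q) (x : F) :
    ∃ v, ∀ w, ‖x + Q v‖ ^ 2 ≤ ‖x + Q w‖ ^ 2 := by
  have hQc := hQ.continuous
  let f : V → ℝ := fun v => ‖x + Q v‖ ^ 2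
  have hf : Continuous f := by fun_prop
  let K : Set V := {v | v ∈ Nᗮ ∧ f v ≤ f 0}
  have hKc : IsClosed K :=
    (Submodule.closed_of_finiteDimensional Nᗮ).inter (isClosed_le hf continuous_const)
  obtain ⟨R, hR⟩ := hQ.exists_norm_le ‖x‖ (f 0)
  have hK : IsCompact K := (isCompact_closedBall (0 : V) R).of_isClosed_subset hKc
    fun v hv => by simpa using hR v hv.1 x le_rfl hv.2
  obtain ⟨v, hv, hmin⟩ := hK.exists_isMinOn ⟨0, Nᗮ.zero_mem, le_rfl⟩ hf.continuousOn
  refine ⟨v, fun w => ?_⟩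
  by_cases hw : f w ≤ f 0
  · have h1 : Nᗮ.starProjection w ∈ K :=
      ⟨Submodule.starProjection_apply_mem _ _, by simpa only [f, hQ.map_starProjection] using hw⟩
    have h2 := hmin h1
    simpa only [Set.mem_ofPred_eq, f, hQ.map_starProjection] using h2
  · exact hv.2.trans (not_le.1 hw).le

/-- At `r = 0` the fiber is the product of the unit sphere of `N` with `Nᗮ`, and replacing `w` by
its projection removes the restriction to `Nᗮ`. -/
lemma exists_isMin_zero_fiber (hQ : IsQuadraticModulo N Q)
    (hN : ∃ γ₀ : Metric.sphere (0 : V) 1, (γ₀ : V) ∈ N) (h : C(Metric.sphere (0 : V) 1, F)) :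
    ∃ γ : Metric.sphere (0 : V) 1, (γ : V) ∈ N ∧ ∃ v, ‖h γ + Q v‖ ^ 2 = fiberMin N Q (0, h) ∧
      ∀ γ' : Metric.sphere (0 : V) 1, (γ' : V) ∈ N → ∀ w,
        ‖h γ + Q v‖ ^ 2 ≤ ‖h γ' + Q w‖ ^ 2 := by
  obtain ⟨⟨γ, v⟩, ⟨hv, hγ⟩, hy, hmin⟩ := exists_isMinOn_scaledFiber hQ hN (0, h)
  simp only [zero_smul] at hγ
  rw [Submodule.starProjection_apply_eq_zero_iff, Submodule.orthogonal_orthogonal] at hγ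
  refine ⟨γ, hγ, v, hy, fun γ' hγ' w => ?_⟩
  have h1 : (γ', Nᗮ.starProjection w) ∈ scaledFiber N 0 := by
    refine ⟨Submodule.starProjection_apply_mem _ _, ?_⟩
    simp only [zero_smul]
    rwa [Submodule.starProjection_apply_eq_zero_iff, Submodule.orthogonal_orthogonal]
  have h2 := hmin _ h1
  simpa only [hQ.map_starProjection] using h2

end FormMinimum

/-! ### Second moments of limits of martingale difference sums. -/

section MartingaleDifferences

variable {Ω : Type*} {mΩ : MeasurableSpace Ω} {P : Measure Ω}

lemma integral_mul_eq_zero_of_condExp_eq_zero [IsFiniteMeasure P] {𝒢 : MeasurableSpace Ω}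
    (h𝒢 : 𝒢 ≤ mΩ) {f g : Ω → ℝ} (hf : StronglyMeasurable[𝒢] f)
    (hfg : Integrable (fun ω => f ω * g ω) P) (hg : Integrable g P) (h0 : P[g | 𝒢] =ᵐ[P] 0) :
    ∫ ω, f ω * g ω ∂P = 0 := by
  rw [← integral_condExp h𝒢]
  refine integral_eq_zero_of_ae ?_
  have h1 : P[f * g | 𝒢] =ᵐ[P] f * P[g | 𝒢] := condExp_mul_of_stronglyMeasurable_left hf hfg hg
  filter_upwards [h1, h0] with ω h2 h3
  rw [show (fun ω => f ω * g ω) = f * g from rfl, h2, Pi.mul_apply, h3]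
  simp

/-- `ξ t` is a martingale difference: `ℱ (t + 1)`-measurable with `E[ξ t | ℱ t] = 0`. -/
structure IsMartingaleDifference (ξ : ℕ → Ω → ℝ) (ℱ : Filtration ℕ mΩ) (P : Measure Ω) : Prop where
  stronglyMeasurable : ∀ t, StronglyMeasurable[ℱ (t + 1)] (ξ t)
  condExp_eq_zero : ∀ t, P[ξ t | ℱ t] =ᵐ[P] 0

namespace IsMartingaleDifference

variable {ξ : ℕ → Ω → ℝ} {ℱ : Filtration ℕ mΩ}

lemma stronglyMeasurable_sum (h : IsMartingaleDifference ξ ℱ P) (n : ℕ) :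
    StronglyMeasurable[ℱ n] (fun ω => ∑ t ∈ Finset.range n, ξ t ω) := by
  refine Finset.stronglyMeasurable_fun_sum _ fun t ht => ?_
  exact (h.stronglyMeasurable t).mono (ℱ.mono (Finset.mem_range.1 ht))

lemma aestronglyMeasurable (h : IsMartingaleDifference ξ ℱ P) (t : ℕ) :
    AEStronglyMeasurable (ξ t) P :=
  ((h.stronglyMeasurable t).mono (ℱ.le _)).aestronglyMeasurable

lemma memLp_sum {p : ENNReal} (hL : ∀ t, MemLp (ξ t) p P) (n : ℕ) :
    MemLp (fun ω => ∑ t ∈ Finset.range n, ξ t ω) p P :=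
  memLp_finsetSum _ fun t _ => hL t

lemma integral_sum_sq [IsProbabilityMeasure P] (h : IsMartingaleDifference ξ ℱ P)
    (hL : ∀ t, MemLp (ξ t) 2 P) (n : ℕ) :
    ∫ ω, (∑ t ∈ Finset.range n, ξ t ω) ^ 2 ∂P =
      ∑ t ∈ Finset.range n, ∫ ω, ξ t ω ^ 2 ∂P := by
  induction n with
  | zero => simp
  | succ n ih =>
    have hS := memLp_sum hL n
    have hSd : Integrable (fun ω => (∑ t ∈ Finset.range n, ξ t ω) * ξ n ω) P :=
      hS.integrable_mul (hL n)
    have h0 := integral_mul_eq_zero_of_condExp_eq_zero (ℱ.le n) (h.stronglyMeasurable_sum n) hSd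
      ((hL n).integrable one_le_two) (h.condExp_eq_zero n)
    rw [Finset.sum_range_succ, ← ih]
    calc ∫ ω, (∑ t ∈ Finset.range (n + 1), ξ t ω) ^ 2 ∂P
        = ∫ ω, ((∑ t ∈ Finset.range n, ξ t ω) ^ 2 +
            2 * ((∑ t ∈ Finset.range n, ξ t ω) * ξ n ω)) + ξ n ω ^ 2 ∂P := by
          congr 1
          ext ω
          rw [Finset.sum_range_succ]
          ring
      _ = _ := by
          rw [integral_add (hS.integrable_sq.fun_add (hSd.const_mul 2)) (hL n).integrable_sq,
            integral_add hS.integrable_sq (hSd.const_mul 2), integral_const_mul, h0]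
          ring

/-- The order `n²` is what matters: normalized sums of bounded differences have fourth moments
bounded in `n`. -/
lemma integral_sum_pow_four_le [IsProbabilityMeasure P] (h : IsMartingaleDifference ξ ℱ P) {B : ℝ}
    (hB : 0 ≤ B) (hb : ∀ t, ∀ᵐ ω ∂P, |ξ t ω| ≤ B) (n : ℕ) :
    ∫ ω, (∑ t ∈ Finset.range n, ξ t ω) ^ 4 ∂P ≤ 4 * (n : ℝ) ^ 2 * B ^ 4 := by
  have hL : ∀ t, MemLp (ξ t) 2 P := fun t => MemLp.of_bound (h.aestronglyMeasurable t) B (hb t)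
  have hm : ∀ n, AEStronglyMeasurable (fun ω => ∑ t ∈ Finset.range n, ξ t ω) P := fun n =>
    ((h.stronglyMeasurable_sum n).mono (ℱ.le n)).aestronglyMeasurable
  have hSb : ∀ n : ℕ, ∀ᵐ ω ∂P, |∑ t ∈ Finset.range n, ξ t ω| ≤ n * B := by
    intro n
    filter_upwards [ae_all_iff.2 hb] with ω hω
    refine (Finset.abs_sum_le_sum_abs _ _).trans ((Finset.sum_le_sum fun t _ => hω t).trans ?_)
    simp
  have hpow : ∀ n j : ℕ, Integrable (fun ω => (∑ t ∈ Finset.range n, ξ t ω) ^ j) P := by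
    intro n j
    refine Integrable.of_bound ((hm n).pow j) ((n * B) ^ j) ?_
    filter_upwards [hSb n] with ω hω
    rw [Real.norm_eq_abs, abs_pow]
    gcongr
  induction n with
  | zero => simp
  | succ n ih =>
    have hSd : Integrable (fun ω => (∑ t ∈ Finset.range n, ξ t ω) ^ 3 * ξ n ω) P := by
      refine (hpow n 3).mul_bdd (c := B) (h.aestronglyMeasurable n) ?_
      filter_upwards [hb n] with ω hω using hω
    have h0 : ∫ ω, (∑ t ∈ Finset.range n, ξ t ω) ^ 3 * ξ n ω ∂P = 0 :=
      integral_mul_eq_zero_of_condExp_eq_zero (ℱ.le n)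
      ((h.stronglyMeasurable_sum n).pow 3) hSd ((hL n).integrable one_le_two)
      (h.condExp_eq_zero n)
    have h2 : ∫ ω, (∑ t ∈ Finset.range n, ξ t ω) ^ 2 ∂P ≤ n * B ^ 2 := by
      rw [h.integral_sum_sq hL]
      calc ∑ t ∈ Finset.range n, ∫ ω, ξ t ω ^ 2 ∂P ≤ ∑ t ∈ Finset.range n, B ^ 2 := by
            refine Finset.sum_le_sum fun t _ => ?_
            calc ∫ ω, ξ t ω ^ 2 ∂P ≤ ∫ _, B ^ 2 ∂P := by
                  refine integral_mono_ae (hL t).integrable_sq (integrable_const _) ?_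
                  filter_upwards [hb t] with ω hω
                  exact sq_le_sq' (abs_le.1 hω).1 (abs_le.1 hω).2
              _ = B ^ 2 := by simp
        _ = n * B ^ 2 := by simp
    -- In the expansion of `(s + d)⁴` the term `4 s d³` is at most `2 s² d² + 2 d⁴`. The term `s³ d`
    -- is kept exactly because its integral vanishes.
    have hpt : ∀ᵐ ω ∂P, (∑ t ∈ Finset.range (n + 1), ξ t ω) ^ 4 ≤
        (∑ t ∈ Finset.range n, ξ t ω) ^ 4 + 4 * ((∑ t ∈ Finset.range n, ξ t ω) ^ 3 * ξ n ω) +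
          8 * B ^ 2 * (∑ t ∈ Finset.range n, ξ t ω) ^ 2 + 3 * B ^ 4 := by
      filter_upwards [hb n] with ω hω
      rw [Finset.sum_range_succ]
      generalize (∑ t ∈ Finset.range n, ξ t ω) = s
      have hd : ξ n ω ^ 2 ≤ B ^ 2 := sq_le_sq' (abs_le.1 hω).1 (abs_le.1 hω).2
      have hd4 : ξ n ω ^ 4 ≤ B ^ 4 := by
        calc ξ n ω ^ 4 = (ξ n ω ^ 2) ^ 2 := by ring
          _ ≤ (B ^ 2) ^ 2 := by gcongr
          _ = B ^ 4 := by ring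
      have h5 : s ^ 2 * ξ n ω ^ 2 ≤ s ^ 2 * B ^ 2 := by gcongr
      nlinarith [sq_nonneg (s * ξ n ω - ξ n ω ^ 2)]
    have hi1 := ((hpow n 4).fun_add (hSd.const_mul 4)).fun_add ((hpow n 2).const_mul (8 * B ^ 2))
    calc ∫ ω, (∑ t ∈ Finset.range (n + 1), ξ t ω) ^ 4 ∂P
        ≤ ∫ ω, (∑ t ∈ Finset.range n, ξ t ω) ^ 4 + 4 * ((∑ t ∈ Finset.range n, ξ t ω) ^ 3 * ξ n ω) +
          8 * B ^ 2 * (∑ t ∈ Finset.range n, ξ t ω) ^ 2 + 3 * B ^ 4 ∂P :=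
          integral_mono_ae (hpow (n + 1) 4) (hi1.add (integrable_const _)) hpt
      _ = ∫ ω, (∑ t ∈ Finset.range n, ξ t ω) ^ 4 ∂P +
          8 * B ^ 2 * ∫ ω, (∑ t ∈ Finset.range n, ξ t ω) ^ 2 ∂P + 3 * B ^ 4 := by
          rw [integral_add hi1 (integrable_const _), integral_add ((hpow n 4).fun_add
            (hSd.const_mul 4)) ((hpow n 2).const_mul (8 * B ^ 2)), integral_add (hpow n 4)
            (hSd.const_mul 4), integral_const_mul, integral_const_mul, h0]
          simp
      _ ≤ 4 * (n : ℝ) ^ 2 * B ^ 4 + 8 * B ^ 2 * (n * B ^ 2) + 3 * B ^ 4 := by gcongr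
      -- The induction closes because `4n² + 8n + 3 ≤ 4(n + 1)²`.
      _ ≤ 4 * ((n + 1 : ℕ) : ℝ) ^ 2 * B ^ 4 := by
          push_cast
          nlinarith [pow_nonneg hB 4]

end IsMartingaleDifference

/-- Meant for `x` with bounded fourth moment and `y` small in mean square: the first term vanishes
for large `K`, the second is small uniformly in `K`. -/
lemma sq_sub_min_le (x y : ℝ) {K : ℝ} (hK : 0 < K) :
    (x + y) ^ 2 - min ((x + y) ^ 2) K ≤ 4 / K * x ^ 4 + 2 * y ^ 2 := by
  have h1 : (x + y) ^ 2 ≤ 2 * x ^ 2 + 2 * y ^ 2 := by nlinarith [sq_nonneg (x - y)]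
  have h4 : 0 ≤ 4 / K * x ^ 4 := by positivity
  rcases le_total ((x + y) ^ 2) K with h | h
  · rw [min_eq_left h, sub_self]
    positivity
  · rw [min_eq_right h]
    have h5 : 2 * x ^ 2 - K ≤ 4 / K * x ^ 4 := by
      rw [div_mul_eq_mul_div, le_div_iff₀ hK]
      nlinarith [sq_nonneg (2 * x ^ 2 - K), sq_nonneg x]
    linarith

/-- Pythagoras: `f - E[f | 𝒢]` is orthogonal to `E[f | 𝒢]`. -/
lemma integral_sub_condExp_sq_le [IsProbabilityMeasure P] {𝒢 : MeasurableSpace Ω} (h𝒢 : 𝒢 ≤ mΩ)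
    {f : Ω → ℝ} (hf : MemLp f 2 P) :
    ∫ ω, (f ω - (P[f | 𝒢]) ω) ^ 2 ∂P ≤ ∫ ω, f ω ^ 2 ∂P := by
  have he : MemLp (P[f | 𝒢]) 2 P := hf.condExp one_le_two
  have hfe : MemLp (fun ω => f ω - (P[f | 𝒢]) ω) 2 P := hf.sub he
  have hi : Integrable (fun ω => (P[f | 𝒢]) ω * (f ω - (P[f | 𝒢]) ω)) P := he.integrable_mul hfe
  have hz : P[fun ω => f ω - (P[f | 𝒢]) ω | 𝒢] =ᵐ[P] 0 := by
    refine (condExp_sub (hf.integrable one_le_two) integrable_condExp 𝒢).trans ?_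
    rw [condExp_of_stronglyMeasurable h𝒢 stronglyMeasurable_condExp integrable_condExp, sub_self]
  have h0 := integral_mul_eq_zero_of_condExp_eq_zero h𝒢 stronglyMeasurable_condExp hi
    (hfe.integrable one_le_two) hz
  have h1 : ∫ ω, f ω ^ 2 ∂P = ∫ ω, ((f ω - (P[f | 𝒢]) ω) ^ 2 +
      2 * ((P[f | 𝒢]) ω * (f ω - (P[f | 𝒢]) ω))) + (P[f | 𝒢]) ω ^ 2 ∂P := by
    congr 1
    ext ω
    ring
  rw [h1, integral_add (hfe.integrable_sq.fun_add (hi.const_mul 2)) he.integrable_sq,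
    integral_add hfe.integrable_sq (hi.const_mul 2), integral_const_mul, h0]
  have h2 : 0 ≤ ∫ ω, (P[f | 𝒢]) ω ^ 2 ∂P := integral_nonneg fun _ => sq_nonneg _
  linarith

/-- `x` where `|x| ≤ M`, and zero elsewhere. -/
def truncate (M x : ℝ) : ℝ := Set.indicator {x : ℝ | |x| ≤ M} id x

lemma measurable_truncate (M : ℝ) : Measurable (truncate M) :=
  measurable_id.indicator (measurableSet_le measurable_abs measurable_const)

lemma abs_truncate_le {M : ℝ} (hM : 0 ≤ M) (x : ℝ) : |truncate M x| ≤ M := by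
  by_cases h : |x| ≤ M <;> simp [truncate, h, hM]

lemma abs_sub_truncate_le (M x : ℝ) : |x - truncate M x| ≤ |x| := by
  by_cases h : |x| ≤ M <;> simp [truncate, h]

lemma tendsto_integral_sub_truncate_sq {f : Ω → ℝ} (hf : MemLp f 2 P) :
    Tendsto (fun M : ℕ => ∫ ω, (f ω - truncate M (f ω)) ^ 2 ∂P) atTop (𝓝 0) := by
  have h := tendsto_integral_of_dominated_convergence (μ := P) (f := fun _ => (0 : ℝ))
    (F := fun (M : ℕ) ω => (f ω - truncate M (f ω)) ^ 2) (fun ω => f ω ^ 2) ?_ hf.integrable_sq ?_ ?_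
  · simpa using h
  · intro M
    have h1 := hf.aestronglyMeasurable.aemeasurable
    exact ((h1.sub ((measurable_truncate M).comp_aemeasurable h1)).pow_const 2).aestronglyMeasurable
  · intro M
    refine ae_of_all _ fun ω => ?_
    rw [Real.norm_eq_abs, abs_of_nonneg (sq_nonneg _)]
    exact sq_le_sq.2 (abs_sub_truncate_le _ _)
  · refine ae_of_all _ fun ω => ?_
    refine tendsto_const_nhds.congr' ?_
    filter_upwards [eventually_ge_atTop ⌈|f ω|⌉₊] with M hM
    have : |f ω| ≤ M := Nat.ceil_le.1 hM
    simp [truncate, this]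

/-- Truncating the terms of a square integrable sequence of identically distributed martingale
differences bounds the part of the second moment of the normalized sum above the level `K`. -/
lemma IsMartingaleDifference.integral_sq_sub_integral_min_le [IsProbabilityMeasure P]
    {ξ : ℕ → Ω → ℝ} {ℱ : Filtration ℕ mΩ} (h : IsMartingaleDifference ξ ℱ P)
    (hL : MemLp (ξ 0) 2 P) (hid : ∀ t, IdentDistrib (ξ t) (ξ 0) P P) {M K : ℝ} (hM : 0 ≤ M)
    (hK : 0 < K) {T : ℕ} (hT : T ≠ 0) :
    ∫ ω, ξ 0 ω ^ 2 ∂P - ∫ ω, min (((√T)⁻¹ * ∑ t ∈ Finset.range T, ξ t ω) ^ 2) K ∂P ≤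
      256 * M ^ 4 / K + 2 * ∫ ω, (ξ 0 ω - truncate M (ξ 0 ω)) ^ 2 ∂P := by
  have hLt : ∀ t, MemLp (ξ t) 2 P := fun t => (hid t).symm.memLp_snd hL
  have hTr : (0 : ℝ) < T := by exact_mod_cast Nat.pos_of_ne_zero hT
  let a : ℕ → Ω → ℝ := fun t ω => truncate M (ξ t ω)
  have hasm : ∀ t, StronglyMeasurable[ℱ (t + 1)] (a t) := fun t =>
    ((measurable_truncate M).comp (h.stronglyMeasurable t).measurable).stronglyMeasurable
  have haL : ∀ t, MemLp (a t) 2 P := fun t =>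
    MemLp.of_bound ((hasm t).mono (ℱ.le _)).aestronglyMeasurable M
      (ae_of_all _ fun ω => abs_truncate_le hM _)
  -- Truncation destroys the martingale property, so the truncated term is recentred conditionally;
  -- this costs a factor two in the bound.
  let x : ℕ → Ω → ℝ := fun t ω => a t ω - (P[a t | ℱ t]) ω
  let y : ℕ → Ω → ℝ := fun t ω => ξ t ω - x t ω
  have hx : IsMartingaleDifference x ℱ P := by
    refine ⟨fun t => (hasm t).sub (stronglyMeasurable_condExp.mono (ℱ.mono t.le_succ)), fun t => ?_⟩
    refine (condExp_sub ((haL t).integrable one_le_two) integrable_condExp _).trans ?_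
    rw [condExp_of_stronglyMeasurable (ℱ.le t) stronglyMeasurable_condExp integrable_condExp,
      sub_self]
  have hxL : ∀ t, MemLp (x t) 2 P := fun t => (haL t).sub ((haL t).condExp one_le_two)
  have hyL : ∀ t, MemLp (y t) 2 P := fun t => (hLt t).sub (hxL t)
  have hy : IsMartingaleDifference y ℱ P := by
    refine ⟨fun t => (h.stronglyMeasurable t).sub (hx.stronglyMeasurable t), fun t => ?_⟩
    refine (condExp_sub ((hLt t).integrable one_le_two) ((hxL t).integrable one_le_two) _).trans ?_
    filter_upwards [h.condExp_eq_zero t, hx.condExp_eq_zero t] with ω h1 h2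
    simp [h1, h2]
  have hxb : ∀ t, ∀ᵐ ω ∂P, |x t ω| ≤ 2 * M := by
    intro t
    have h1 : ∀ᵐ ω ∂P, |(P[a t | ℱ t]) ω| ≤ M :=
      ae_bdd_abs_condExp_of_ae_bdd_abs (ae_of_all _ fun ω => abs_truncate_le hM _)
    filter_upwards [h1] with ω h2
    have h3 : |a t ω| ≤ M := abs_truncate_le hM _
    have := abs_sub (a t ω) ((P[a t | ℱ t]) ω)
    simp only [x]
    linarith
  have hysq : ∀ t, ∫ ω, y t ω ^ 2 ∂P ≤ ∫ ω, (ξ 0 ω - truncate M (ξ 0 ω)) ^ 2 ∂P := by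
    intro t
    have h1 : MemLp (fun ω => ξ t ω - a t ω) 2 P := (hLt t).sub (haL t)
    -- Since `E[ξ t | ℱ t] = 0`, the remainder `y t` is the conditionally centred truncation error.
    have h2 : ∫ ω, y t ω ^ 2 ∂P =
        ∫ ω, ((ξ t ω - a t ω) - (P[fun ω => ξ t ω - a t ω | ℱ t]) ω) ^ 2 ∂P := by
      refine integral_congr_ae ?_
      have h3 : P[fun ω => ξ t ω - a t ω | ℱ t] =ᵐ[P] P[ξ t | ℱ t] - P[a t | ℱ t] :=
        condExp_sub ((hLt t).integrable one_le_two) ((haL t).integrable one_le_two) _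
      filter_upwards [h3, h.condExp_eq_zero t] with ω h4 h5
      simp only [h4, Pi.sub_apply, h5, Pi.zero_apply, y, x]
      ring
    rw [h2]
    refine (integral_sub_condExp_sq_le (ℱ.le t) h1).trans_eq ?_
    have h6 := (hid t).comp (u := fun z : ℝ => (z - truncate M z) ^ 2)
      ((measurable_id.sub (measurable_truncate M)).pow_const 2)
    exact h6.integral_eq
  have hSx := hx.integral_sum_pow_four_le (B := 2 * M) (by positivity) hxb T
  have hSy := hy.integral_sum_sq hyL T
  have hS := h.integral_sum_sq hLt T
  have hSL := IsMartingaleDifference.memLp_sum hLt T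
  have hSyL := IsMartingaleDifference.memLp_sum hyL T
  have hsL : MemLp (fun ω => (√T)⁻¹ * ∑ t ∈ Finset.range T, ξ t ω) 2 P := hSL.const_mul _
  have hvar : ∫ ω, ((√T)⁻¹ * ∑ t ∈ Finset.range T, ξ t ω) ^ 2 ∂P = ∫ ω, ξ 0 ω ^ 2 ∂P := by
    simp_rw [mul_pow]
    rw [integral_const_mul, hS]
    have h1 : ∀ t, ∫ ω, ξ t ω ^ 2 ∂P = ∫ ω, ξ 0 ω ^ 2 ∂P := fun t => ((hid t).sq).integral_eq
    simp only [h1, Finset.sum_const, Finset.card_range, nsmul_eq_mul, inv_pow,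
      Real.sq_sqrt hTr.le]
    field_simp
  have hmin : Integrable (fun ω => min (((√T)⁻¹ * ∑ t ∈ Finset.range T, ξ t ω) ^ 2) K) P :=
    hsL.integrable_sq.inf (integrable_const K)
  have hx4 : Integrable (fun ω => (∑ t ∈ Finset.range T, x t ω) ^ 4) P := by
    refine Integrable.of_bound (C := (T * (2 * M)) ^ 4)
      (((hx.stronglyMeasurable_sum T).mono (ℱ.le T)).aestronglyMeasurable.pow 4) ?_
    filter_upwards [ae_all_iff.2 hxb] with ω hω
    rw [Real.norm_eq_abs, abs_pow]
    gcongr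
    refine (Finset.abs_sum_le_sum_abs _ _).trans ((Finset.sum_le_sum fun t _ => hω t).trans ?_)
    simp
  rw [← hvar, ← integral_sub hsL.integrable_sq hmin]
  calc ∫ ω, ((√T)⁻¹ * ∑ t ∈ Finset.range T, ξ t ω) ^ 2 -
        min (((√T)⁻¹ * ∑ t ∈ Finset.range T, ξ t ω) ^ 2) K ∂P
      ≤ ∫ ω, 4 / K * ((T : ℝ)⁻¹ ^ 2 * (∑ t ∈ Finset.range T, x t ω) ^ 4) +
          2 * ((T : ℝ)⁻¹ * (∑ t ∈ Finset.range T, y t ω) ^ 2) ∂P := by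
        refine integral_mono (hsL.integrable_sq.sub hmin)
          (((hx4.const_mul _).const_mul _).add ((hSyL.integrable_sq.const_mul _).const_mul _))
          fun ω => ?_
        have h1 := sq_sub_min_le ((√T)⁻¹ * ∑ t ∈ Finset.range T, x t ω)
          ((√T)⁻¹ * ∑ t ∈ Finset.range T, y t ω) hK
        have h2 : (√T)⁻¹ * ∑ t ∈ Finset.range T, x t ω + (√T)⁻¹ * ∑ t ∈ Finset.range T, y t ω =
            (√T)⁻¹ * ∑ t ∈ Finset.range T, ξ t ω := by
          rw [← mul_add, ← Finset.sum_add_distrib]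
          simp [y]
        have h3 : (√T)⁻¹ ^ 2 = (T : ℝ)⁻¹ := by rw [inv_pow, Real.sq_sqrt hTr.le]
        have h4 : (√T)⁻¹ ^ 4 = (T : ℝ)⁻¹ ^ 2 := by rw [← h3]; ring
        rw [h2, mul_pow _ _ 4, h4, mul_pow _ (∑ t ∈ Finset.range T, y t ω) 2, h3] at h1
        exact h1
    _ = 4 / K * ((T : ℝ)⁻¹ ^ 2 * ∫ ω, (∑ t ∈ Finset.range T, x t ω) ^ 4 ∂P) +
          2 * ((T : ℝ)⁻¹ * ∫ ω, (∑ t ∈ Finset.range T, y t ω) ^ 2 ∂P) := by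
        rw [integral_add ((hx4.const_mul _).const_mul _)
          ((hSyL.integrable_sq.const_mul _).const_mul _)]
        simp_rw [integral_const_mul]
    -- The constant 256 is `4 · 4 · 2⁴`: from `sq_sub_min_le`, from the fourth moment bound, and
    -- from `|x t| ≤ 2M`.
    _ ≤ 4 / K * ((T : ℝ)⁻¹ ^ 2 * (4 * (T : ℝ) ^ 2 * (2 * M) ^ 4)) +
          2 * ((T : ℝ)⁻¹ * ∑ t ∈ Finset.range T, ∫ ω, (ξ 0 ω - truncate M (ξ 0 ω)) ^ 2 ∂P) := by
        rw [hSy]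
        refine add_le_add (by gcongr) (mul_le_mul_of_nonneg_left (mul_le_mul_of_nonneg_left
          (Finset.sum_le_sum fun t _ => hysq t) (by positivity)) (by positivity))
    _ = 256 * M ^ 4 / K + 2 * ∫ ω, (ξ 0 ω - truncate M (ξ 0 ω)) ^ 2 ∂P := by
        simp only [Finset.sum_const, Finset.card_range, nsmul_eq_mul]
        field_simp
        ring

/-- If the normalized sums of square integrable, identically distributed martingale differences
converge in distribution, then the second moment of the limit is that of the summands. -/
theorem IsMartingaleDifference.integral_sq_limit [IsProbabilityMeasure P] {ξ : ℕ → Ω → ℝ}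
    {ℱ : Filtration ℕ mΩ} (h : IsMartingaleDifference ξ ℱ P) (hL : MemLp (ξ 0) 2 P)
    (hid : ∀ t, IdentDistrib (ξ t) (ξ 0) P P) {Ω' : Type*} {mΩ' : MeasurableSpace Ω'}
    {P' : Measure Ω'} [IsProbabilityMeasure P'] {X : Ω' → ℝ} (hX : MemLp X 2 P')
    (hlim : TendstoInDistribution (fun (T : ℕ) ω => (√T)⁻¹ * ∑ t ∈ Finset.range T, ξ t ω)
      atTop X (fun _ => P) P') :
    ∫ ω, X ω ^ 2 ∂P' = ∫ ω, ξ 0 ω ^ 2 ∂P := by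
  have hLt : ∀ t, MemLp (ξ t) 2 P := fun t => (hid t).symm.memLp_snd hL
  -- The capped square is bounded and continuous, so convergence in law applies to it.
  have hK : ∀ K : ℝ, 0 < K → Tendsto
      (fun T : ℕ => ∫ ω, min (((√T)⁻¹ * ∑ t ∈ Finset.range T, ξ t ω) ^ 2) K ∂P) atTop
      (𝓝 (∫ ω, min (X ω ^ 2) K ∂P')) := by
    intro K hK
    let f : BoundedContinuousFunction ℝ ℝ := BoundedContinuousFunction.ofNormedAddCommGroup
      (fun x : ℝ => min (x ^ 2) K) (by fun_prop) K (fun x => by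
        rw [Real.norm_eq_abs, abs_of_nonneg (le_min (sq_nonneg _) hK.le)]
        exact min_le_right _ _)
    have h1 := (ProbabilityMeasure.tendsto_iff_forall_integral_tendsto.1 hlim.tendsto) f
    simp only [ProbabilityMeasure.coe_mk] at h1
    rw [integral_map hlim.aemeasurable_limit f.continuous.aestronglyMeasurable] at h1
    refine h1.congr fun T => ?_
    rw [integral_map (hlim.forall_aemeasurable T) f.continuous.aestronglyMeasurable]
    rfl
  have hup : ∀ K : ℝ, 0 < K → ∫ ω, min (X ω ^ 2) K ∂P' ≤ ∫ ω, ξ 0 ω ^ 2 ∂P := by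
    intro K hK0
    refine le_of_tendsto (hK K hK0) ?_
    filter_upwards [eventually_ne_atTop 0] with T hT
    have hTr : (0 : ℝ) < T := by exact_mod_cast Nat.pos_of_ne_zero hT
    have hsL : MemLp (fun ω => (√T)⁻¹ * ∑ t ∈ Finset.range T, ξ t ω) 2 P :=
      (memLp_sum hLt T).const_mul _
    calc ∫ ω, min (((√T)⁻¹ * ∑ t ∈ Finset.range T, ξ t ω) ^ 2) K ∂P
        ≤ ∫ ω, ((√T)⁻¹ * ∑ t ∈ Finset.range T, ξ t ω) ^ 2 ∂P :=
          integral_mono (hsL.integrable_sq.inf (integrable_const K)) hsL.integrable_sq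
            fun ω => min_le_left _ _
      _ = ∫ ω, ξ 0 ω ^ 2 ∂P := by
          simp_rw [mul_pow]
          rw [integral_const_mul, h.integral_sum_sq hLt T]
          have h1 : ∀ t, ∫ ω, ξ t ω ^ 2 ∂P = ∫ ω, ξ 0 ω ^ 2 ∂P := fun t =>
            ((hid t).sq).integral_eq
          simp only [h1, Finset.sum_const, Finset.card_range, nsmul_eq_mul, inv_pow,
            Real.sq_sqrt hTr.le]
          field_simp
  have hlow : ∀ M : ℕ, ∀ K : ℝ, 0 < K → ∫ ω, ξ 0 ω ^ 2 ∂P - ∫ ω, min (X ω ^ 2) K ∂P' ≤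
      256 * (M : ℝ) ^ 4 / K + 2 * ∫ ω, (ξ 0 ω - truncate M (ξ 0 ω)) ^ 2 ∂P := by
    intro M K hK0
    refine le_of_tendsto ((hK K hK0).const_sub _) ?_
    filter_upwards [eventually_ne_atTop 0] with T hT
    exact h.integral_sq_sub_integral_min_le hL hid (Nat.cast_nonneg M) hK0 hT
  have hXK : Tendsto (fun K : ℝ => ∫ ω, min (X ω ^ 2) K ∂P') atTop
      (𝓝 (∫ ω, X ω ^ 2 ∂P')) := by
    refine tendsto_integral_filter_of_dominated_convergence (fun ω => X ω ^ 2) ?_ ?_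
      hX.integrable_sq ?_
    · exact Eventually.of_forall fun K =>
        (hX.aestronglyMeasurable.pow 2).inf aestronglyMeasurable_const
    · filter_upwards [eventually_ge_atTop 0] with K hK0
      refine ae_of_all _ fun ω => ?_
      rw [Real.norm_eq_abs, abs_of_nonneg (le_min (sq_nonneg _) hK0)]
      exact min_le_left _ _
    · refine ae_of_all _ fun ω => tendsto_const_nhds.congr' ?_
      filter_upwards [eventually_ge_atTop (X ω ^ 2)] with K hK0
      exact (min_eq_left hK0).symm
  refine le_antisymm (le_of_tendsto hXK ?_) ?_
  · filter_upwards [eventually_gt_atTop 0] with K hK0 using hup K hK0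
  -- The order of limits matters: `K → ∞` at fixed truncation level `M`, then `M → ∞`.
  · have h1 : ∀ M : ℕ, ∫ ω, ξ 0 ω ^ 2 ∂P - ∫ ω, X ω ^ 2 ∂P' ≤
        2 * ∫ ω, (ξ 0 ω - truncate M (ξ 0 ω)) ^ 2 ∂P := by
      intro M
      have h2 : Tendsto (fun K : ℝ => 256 * (M : ℝ) ^ 4 / K +
          2 * ∫ ω, (ξ 0 ω - truncate M (ξ 0 ω)) ^ 2 ∂P) atTop
          (𝓝 (0 + 2 * ∫ ω, (ξ 0 ω - truncate M (ξ 0 ω)) ^ 2 ∂P)) :=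
        (tendsto_const_nhds.div_atTop tendsto_id).add_const _
      rw [zero_add] at h2
      refine le_of_tendsto_of_tendsto (hXK.const_sub _) h2 ?_
      filter_upwards [eventually_gt_atTop 0] with K hK0 using hlow M K hK0
    have h3 := ge_of_tendsto ((tendsto_integral_sub_truncate_sq hL).const_mul 2)
      (Eventually.of_forall h1)
    linarith

end MartingaleDifferences

/-! ### Conditional variances in the factor model. -/

section ModelConsequences

variable {Ω : Type*} {mΩ : MeasurableSpace Ω} {k m p : ℕ}

/-- Quadratic expressions in `γ` become linear in the entries of `Y Yᵀ`, hence in the stacked vector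
of the CLT. -/
lemma inner_sq_eq_sum_vec (x y : E k) :
    (inner ℝ x y) ^ 2 = ∑ a, (outer x).vec a * (outer y).vec a := by
  rw [Fintype.sum_prod_type, PiLp.inner_apply, sq, Finset.sum_mul_sum]
  refine Finset.sum_congr rfl fun i _ => Finset.sum_congr rfl fun j _ => ?_
  simp only [Matrix.vec, outer, Matrix.vecMulVec_apply, RCLike.inner_apply, conj_trivial]
  ring

lemma sum_vec_outer_mul_vec (x : E k) (M : Matrix (Fin k) (Fin k) ℝ) :
    ∑ a, (outer x).vec a * M.vec a = x.ofLp ⬝ᵥ M.mulVec x.ofLp := by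
  rw [Fintype.sum_prod_type_right, dotProduct]
  refine Finset.sum_congr rfl fun i _ => ?_
  rw [Matrix.mulVec, dotProduct, Finset.mul_sum]
  refine Finset.sum_congr rfl fun j _ => ?_
  simp only [Matrix.vec, outer, Matrix.vecMulVec_apply]
  ring

/-- The conditional variance `γᵀ (Λ D_t Λᵀ + Om) γ` of `γᵀ Y_{t+1}`. -/
def condVar (Λ : Matrix (Fin k) (Fin p) ℝ) (σ : ℕ → Ω → Fin p → ℝ) (Om : Matrix (Fin k) (Fin k) ℝ)
    (γ : E k) (t : ℕ) (ω : Ω) : ℝ :=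
  ∑ j, (Matrix.vecMul γ.ofLp Λ j) ^ 2 * σ t ω j ^ 2 + γ.ofLp ⬝ᵥ Om.mulVec γ.ofLp

lemma condVar_eq (Λ : Matrix (Fin k) (Fin p) ℝ) (σ : ℕ → Ω → Fin p → ℝ)
    (Om : Matrix (Fin k) (Fin k) ℝ) (γ : E k) (t : ℕ) (ω : Ω) :
    condVar Λ σ Om γ t ω = γ.ofLp ⬝ᵥ
      (Λ * Matrix.diagonal (fun j => σ t ω j ^ 2) * Λ.transpose + Om).mulVec γ.ofLp := by
  rw [Matrix.add_mulVec, dotProduct_add, ← Matrix.mulVec_mulVec, ← Matrix.mulVec_mulVec,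
    Matrix.dotProduct_mulVec, Matrix.mulVec_transpose, condVar]
  congr 1
  rw [dotProduct]
  refine Finset.sum_congr rfl fun j _ => ?_
  rw [Matrix.mulVec_diagonal]
  ring

variable {P : Measure Ω} {ℱ : Filtration ℕ mΩ} {Y : ℕ → Ω → E k} {Z : ℕ → Ω → E m}
  {Λ : Matrix (Fin k) (Fin p) ℝ} {σ : ℕ → Ω → Fin p → ℝ} {Om : Matrix (Fin k) (Fin k) ℝ}

lemma memLp_vec_outer (hL : ∀ t, MemLp (stacked Y Z t) 2 P) (t : ℕ) (a : Fin k × Fin k) :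
    MemLp (fun ω => (outer (Y (t + 1) ω)).vec a) 2 P :=
  (hL t).eval_piLp (Sum.inr (Sum.inl a))

lemma memLp_instrument (hL : ∀ t, MemLp (stacked Y Z t) 2 P) (t : ℕ) (i : Fin m) :
    MemLp (fun ω => Z t ω i) 2 P :=
  (hL t).eval_piLp (Sum.inl i)

lemma memLp_vec_outer_mul (hL : ∀ t, MemLp (stacked Y Z t) 2 P) (t : ℕ) (a : Fin k × Fin k)
    (i : Fin m) : MemLp (fun ω => (outer (Y (t + 1) ω)).vec a * Z t ω i) 2 P :=
  (hL t).eval_piLp (Sum.inr (Sum.inr (a, i)))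

lemma memLp_inner_sq (hL : ∀ t, MemLp (stacked Y Z t) 2 P) (t : ℕ) (γ : E k) :
    MemLp (fun ω => (inner ℝ γ (Y (t + 1) ω)) ^ 2) 2 P := by
  simp_rw [inner_sq_eq_sum_vec]
  exact memLp_finsetSum _ fun a _ => (memLp_vec_outer hL t a).const_mul _

lemma memLp_inner_sq_mul (hL : ∀ t, MemLp (stacked Y Z t) 2 P) (t : ℕ) (γ : E k) (i : Fin m) :
    MemLp (fun ω => (inner ℝ γ (Y (t + 1) ω)) ^ 2 * Z t ω i) 2 P := by
  simp_rw [inner_sq_eq_sum_vec, Finset.sum_mul, mul_assoc]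
  exact memLp_finsetSum _ fun a _ => (memLp_vec_outer_mul hL t a i).const_mul _

namespace Model

lemma measurable_Y (h : Model P ℱ Y Z Λ σ Om) (t : ℕ) : Measurable (Y t) :=
  (h.adapted_Y t).mono (ℱ.le t) le_rfl

lemma measurable_Z (h : Model P ℱ Y Z Λ σ Om) (t : ℕ) : Measurable (Z t) :=
  (h.adapted_Z t).mono (ℱ.le t) le_rfl

lemma condExp_vec_outer (h : Model P ℱ Y Z Λ σ Om) (t : ℕ) (a : Fin k × Fin k) :
    P[fun ω => (outer (Y (t + 1) ω)).vec a | ℱ t] =ᵐ[P] fun ω =>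
      (Λ * Matrix.diagonal (fun j => σ t ω j ^ 2) * Λ.transpose + Om).vec a := by
  have h1 : P[fun ω => (outer (Y (t + 1) ω)).vec a | ℱ t] =ᵐ[P]
      P[fun ω => (Y (t + 1) ω a.2 - (P[Y (t + 1) | ℱ t]) ω a.2) *
        (Y (t + 1) ω a.1 - (P[Y (t + 1) | ℱ t]) ω a.1) | ℱ t] := by
    refine condExp_congr_ae ?_
    filter_upwards [h.condMean t] with ω hω
    simp [hω, Matrix.vec, outer, Matrix.vecMulVec_apply]
  refine h1.trans ?_
  filter_upwards [h.condVar_eq t] with ω hω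
  simp only [Matrix.vec, ← hω]
  rfl

lemma condExp_inner_sq [IsProbabilityMeasure P] (h : Model P ℱ Y Z Λ σ Om)
    (hL : ∀ t, MemLp (stacked Y Z t) 2 P) (t : ℕ) (γ : E k) :
    P[fun ω => (inner ℝ γ (Y (t + 1) ω)) ^ 2 | ℱ t] =ᵐ[P] condVar Λ σ Om γ t := by
  have h0 : (fun ω => (inner ℝ γ (Y (t + 1) ω)) ^ 2) =
      ∑ a, (outer γ).vec a • fun ω => (outer (Y (t + 1) ω)).vec a := by
    ext ω
    simp [inner_sq_eq_sum_vec]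
  rw [h0]
  refine (condExp_finsetSum (fun a _ =>
    ((memLp_vec_outer hL t a).integrable one_le_two).smul _) (ℱ t)).trans ?_
  have h1 : ∀ a, P[(outer γ).vec a • fun ω => (outer (Y (t + 1) ω)).vec a | ℱ t] =ᵐ[P]
      (outer γ).vec a • P[fun ω => (outer (Y (t + 1) ω)).vec a | ℱ t] :=
    fun a => condExp_smul _ _ _
  filter_upwards [ae_all_iff.2 h1, ae_all_iff.2 (h.condExp_vec_outer t)] with ω h2 h3
  rw [CommonCH.condVar_eq, ← sum_vec_outer_mul_vec, Finset.sum_apply]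
  refine Finset.sum_congr rfl fun a _ => ?_
  rw [h2 a, Pi.smul_apply, h3 a, smul_eq_mul]

lemma stronglyMeasurable_condVar (h : Model P ℱ Y Z Λ σ Om) (t : ℕ) (γ : E k) :
    StronglyMeasurable[ℱ t] (condVar Λ σ Om γ t) := by
  unfold condVar
  refine Measurable.stronglyMeasurable ?_
  exact (Finset.measurable_fun_sum _ fun j _ => (h.adapted_sq t j).const_mul _).add_const _

lemma memLp_condVar [IsProbabilityMeasure P] (h : Model P ℱ Y Z Λ σ Om)
    (hL : ∀ t, MemLp (stacked Y Z t) 2 P) (t : ℕ) (γ : E k) :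
    MemLp (condVar Λ σ Om γ t) 2 P :=
  ((memLp_inner_sq hL t γ).condExp one_le_two).ae_eq (h.condExp_inner_sq hL t γ)

/-- Full column rank of `Λ` makes `Λᵀ` surjective. -/
lemma exists_vecMul_eq (h : Model P ℱ Y Z Λ σ Om) (s : Fin p → ℝ) :
    ∃ γ : E k, Matrix.vecMul γ.ofLp Λ = s := by
  have h1 : Λ.transpose.rank = p := by rw [Matrix.rank_transpose, h.fullRank]
  have h2 : LinearMap.range Λ.transpose.mulVecLin = ⊤ := by
    refine Submodule.eq_top_of_finrank_eq ?_
    rw [← Matrix.rank, h1]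
    simp
  obtain ⟨v, hv⟩ := LinearMap.range_eq_top.1 h2 s
  exact ⟨WithLp.toLp 2 v, by simpa [Matrix.mulVec_transpose] using hv⟩

/-- Choosing `γ` with `Λᵀ γ = e_j` makes the conditional variance equal to `σ_j²` plus a constant,
and a conditional expectation of a square integrable variable is square integrable. -/
lemma memLp_sq [IsProbabilityMeasure P] (h : Model P ℱ Y Z Λ σ Om)
    (hL : ∀ t, MemLp (stacked Y Z t) 2 P) (t : ℕ) (j : Fin p) :
    MemLp (fun ω => σ t ω j ^ 2) 2 P := by
  obtain ⟨γ, hγ⟩ := h.exists_vecMul_eq (Pi.single j 1)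
  have h1 := (h.memLp_condVar hL t γ).sub
    (memLp_const (μ := P) (p := 2) (γ.ofLp ⬝ᵥ Om.mulVec γ.ofLp))
  convert h1 using 1
  ext ω
  simp [condVar, hγ, Pi.single_apply]

/-- As `Z_0` is `ℱ_0`-measurable, `(γᵀ Y_1)²` may be replaced by its conditional expectation, whose
constant part `γᵀ Om γ` drops out of the covariance. -/
lemma integral_mul_inner_sq_sub [IsProbabilityMeasure P] (h : Model P ℱ Y Z Λ σ Om)
    (hL : ∀ t, MemLp (stacked Y Z t) 2 P) (γ : E k) (i : Fin m) :
    ∫ ω, Z 0 ω i * ((inner ℝ γ (Y 1 ω)) ^ 2 - c P Y γ) ∂P =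
      ∑ j, (Matrix.vecMul γ.ofLp Λ j) ^ 2 * cov[fun ω => Z 0 ω i, fun ω => σ 0 ω j ^ 2; P] := by
  have hZ := memLp_instrument hL 0 i
  have hq := memLp_inner_sq hL 0 γ
  have hs := h.memLp_condVar hL 0 γ
  have hZq : Integrable (fun ω => Z 0 ω i * (inner ℝ γ (Y 1 ω)) ^ 2) P := hZ.integrable_mul hq
  have hZs : Integrable (fun ω => Z 0 ω i * condVar Λ σ Om γ 0 ω) P := hZ.integrable_mul hs
  have hqs : MemLp (fun ω => (inner ℝ γ (Y 1 ω)) ^ 2 - condVar Λ σ Om γ 0 ω) 2 P := hq.sub hs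
  have hce := h.condExp_inner_sq hL 0 γ
  have hZm : StronglyMeasurable[ℱ 0] (fun ω => Z 0 ω i) :=
    ((EuclideanSpace.proj (𝕜 := ℝ) i).continuous.measurable.comp
      (h.adapted_Z 0)).stronglyMeasurable
  have h1 : ∫ ω, (inner ℝ γ (Y 1 ω)) ^ 2 ∂P = ∫ ω, condVar Λ σ Om γ 0 ω ∂P := by
    rw [← integral_condExp (ℱ.le 0)]
    exact integral_congr_ae hce
  have h2 : ∫ ω, Z 0 ω i * (inner ℝ γ (Y 1 ω)) ^ 2 ∂P =
      ∫ ω, Z 0 ω i * condVar Λ σ Om γ 0 ω ∂P := by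
    have h3 := integral_mul_eq_zero_of_condExp_eq_zero (ℱ.le 0) hZm (hZ.integrable_mul hqs)
      (hqs.integrable one_le_two) (by
        refine (condExp_sub (hq.integrable one_le_two) (hs.integrable one_le_two) _).trans ?_
        rw [condExp_of_stronglyMeasurable (ℱ.le 0) (h.stronglyMeasurable_condVar 0 γ)
          (hs.integrable one_le_two)]
        filter_upwards [hce] with ω hω
        simp [hω])
    simp_rw [mul_sub] at h3
    rw [integral_sub hZq hZs] at h3
    linarith
  have h4 : ∫ ω, Z 0 ω i * ((inner ℝ γ (Y 1 ω)) ^ 2 - c P Y γ) ∂P =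
      cov[fun ω => Z 0 ω i, condVar Λ σ Om γ 0; P] := by
    simp_rw [mul_sub]
    rw [integral_sub hZq ((hZ.integrable one_le_two).mul_const _), integral_mul_const, c,
      covariance_eq_sub hZ hs, h1, h2]
    rfl
  have hsum : ∀ j, MemLp (fun ω => (Matrix.vecMul γ.ofLp Λ j) ^ 2 * σ 0 ω j ^ 2) 2 P :=
    fun j => (h.memLp_sq hL 0 j).const_mul _
  rw [h4]
  unfold condVar
  rw [covariance_add_const_right ((memLp_finsetSum _ fun j _ => hsum j).integrable one_le_two),
    covariance_fun_sum_right hsum hZ]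
  simp_rw [covariance_const_mul_right]

lemma stationary_pair (h : Model P ℱ Y Z Λ σ Om) (t : ℕ) :
    IdentDistrib (fun ω => ((Y t ω, Z t ω), (Y (t + 1) ω, Z (t + 1) ω)))
      (fun ω => ((Y 0 ω, Z 0 ω), (Y 1 ω, Z 1 ω))) P P := by
  have hm : Measurable fun ω (t : ℕ) => (Y t ω, Z t ω) :=
    measurable_pi_lambda _ fun t => (h.measurable_Y t).prodMk (h.measurable_Z t)
  have hmp := (h.stationaryErgodic.toMeasurePreserving).iterate t
  have hit : ∀ (x : ℕ → E k × E m) (t s : ℕ),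
      ((fun (x : ℕ → E k × E m) (t : ℕ) => x (t + 1))^[t] x) s = x (s + t) := by
    intro x t
    induction t generalizing x with
    | zero => simp
    | succ t ih =>
      intro s
      rw [Function.iterate_succ_apply, ih]
      congr 1
  let g : (ℕ → E k × E m) → (E k × E m) × (E k × E m) := fun x => (x 0, x 1)
  have hg : Measurable g := (measurable_pi_apply 0).prodMk (measurable_pi_apply 1)
  refine ⟨?_, ?_, ?_⟩
  · exact (((measurable_pi_apply t).comp hm).prodMk
      ((measurable_pi_apply (t + 1)).comp hm)).aemeasurable
  · exact (hg.comp hm).aemeasurable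
  · have h1 : P.map (fun ω => ((Y 0 ω, Z 0 ω), (Y 1 ω, Z 1 ω))) =
        (P.map fun ω (t : ℕ) => (Y t ω, Z t ω)).map g := by
      rw [Measure.map_map hg hm]
      rfl
    rw [h1, ← hmp.map_eq, Measure.map_map hg hmp.measurable,
      Measure.map_map (hg.comp hmp.measurable) hm]
    congr 1
    ext1 ω
    simp only [g, Function.comp_apply, hit, zero_add, add_comm 1 t]

end Model

/-! ### The quadratic map `v ↦ G vec(v vᵀ)` and the identified set. -/

lemma vec_outer_continuous (a : Fin k × Fin k) : Continuous fun y : E k => (outer y).vec a := by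
  simp only [Matrix.vec, outer, Matrix.vecMulVec_apply]
  fun_prop

/-- The function `v ↦ G vec(v vᵀ)`. -/
def gForm (P : Measure Ω) (Y : ℕ → Ω → E k) (Z : ℕ → Ω → E m) (v : E k) : E m :=
  WithLp.toLp 2 ((Gmat P Y Z).mulVec (outer v).vec)

lemma c_eq_sum [IsProbabilityMeasure P] (hL : ∀ t, MemLp (stacked Y Z t) 2 P) (v : E k) :
    c P Y v = ∑ a, (outer v).vec a * ∫ ω, (outer (Y 1 ω)).vec a ∂P := by
  unfold c
  simp_rw [inner_sq_eq_sum_vec]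
  rw [integral_finsetSum _ fun a _ =>
    (((memLp_vec_outer hL 0 a).integrable one_le_two).const_mul _)]
  simp_rw [zero_add, integral_const_mul]

lemma gForm_apply [IsProbabilityMeasure P] (hL : ∀ t, MemLp (stacked Y Z t) 2 P) (v : E k)
    (i : Fin m) :
    gForm P Y Z v i = ∫ ω, Z 0 ω i * ((inner ℝ v (Y 1 ω)) ^ 2 - c P Y v) ∂P := by
  have h1 : ∀ ω, Z 0 ω i * ((inner ℝ v (Y 1 ω)) ^ 2 - c P Y v) = ∑ a, (outer v).vec a *
      (Z 0 ω i * ((outer (Y 1 ω)).vec a - ∫ ω', (outer (Y 1 ω')).vec a ∂P)) := by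
    intro ω
    rw [c_eq_sum hL, inner_sq_eq_sum_vec, ← Finset.sum_sub_distrib, Finset.mul_sum]
    refine Finset.sum_congr rfl fun a _ => ?_
    ring
  simp_rw [h1]
  rw [integral_finsetSum]
  · simp only [gForm, Gmat, Matrix.mulVec, dotProduct, Matrix.of_apply, integral_const_mul]
    refine Finset.sum_congr rfl fun a _ => ?_
    rw [mul_comm]
    rfl
  · intro a _
    refine Integrable.const_mul ?_ _
    exact (memLp_instrument hL 0 i).integrable_mul ((memLp_vec_outer hL 0 a).sub (memLp_const _))

lemma theta0_eq_gForm [IsProbabilityMeasure P] (hL : ∀ t, MemLp (stacked Y Z t) 2 P)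
    (γ : USphere k) : theta0 P Y Z γ = gForm P Y Z γ := by
  ext i
  rw [gForm_apply hL, theta0, eval_integral_piLp]
  · refine integral_congr_ae (ae_of_all _ fun ω => ?_)
    simp [mul_comm]
  · intro i
    simp only [PiLp.smul_apply, smul_eq_mul]
    exact ((memLp_inner_sq hL 0 (γ : E k)).sub (memLp_const _)).integrable_mul
      (memLp_instrument hL 0 i)

/-- The kernel of `Λᵀ`. -/
def loadingKernel (Λ : Matrix (Fin k) (Fin p) ℝ) : Submodule ℝ (E k) :=
  LinearMap.ker (Λ.vecMulLinear ∘ₗ (WithLp.linearEquiv 2 ℝ (Fin k → ℝ)).toLinearMap)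

lemma mem_loadingKernel {Λ : Matrix (Fin k) (Fin p) ℝ} {v : E k} :
    v ∈ loadingKernel Λ ↔ Matrix.vecMul v.ofLp Λ = 0 := Iff.rfl

lemma Model.gForm_eq [IsProbabilityMeasure P] (h : Model P ℱ Y Z Λ σ Om)
    (hL : ∀ t, MemLp (stacked Y Z t) 2 P) (v : E k) :
    gForm P Y Z v = WithLp.toLp 2 ((crossCov (fun ω => (Z 0 ω).ofLp) (fun ω j => σ 0 ω j ^ 2) P).mulVec
      fun j => (Matrix.vecMul v.ofLp Λ j) ^ 2) := by
  ext i
  rw [gForm_apply hL, h.integral_mul_inner_sq_sub hL]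
  simp only [Matrix.mulVec, dotProduct, crossCov, Matrix.of_apply]
  exact Finset.sum_congr rfl fun j _ => mul_comm _ _

lemma Model.isQuadraticModulo [IsProbabilityMeasure P] (h : Model P ℱ Y Z Λ σ Om)
    (hL : ∀ t, MemLp (stacked Y Z t) 2 P) :
    IsQuadraticModulo (loadingKernel Λ) (gForm P Y Z) where
  continuous := by
    unfold gForm
    refine (PiLp.continuous_toLp 2 _).comp (continuous_pi fun i => ?_)
    simp only [Matrix.mulVec, dotProduct]
    exact continuous_finsetSum _ fun a _ => continuous_const.mul (vec_outer_continuous a)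
  map_smul r v := by
    ext i
    simp only [gForm, Matrix.mulVec, dotProduct, PiLp.smul_apply, smul_eq_mul, Finset.mul_sum]
    refine Finset.sum_congr rfl fun a _ => ?_
    simp only [Matrix.vec, outer, Matrix.vecMulVec_apply, PiLp.smul_apply, smul_eq_mul]
    ring
  map_add a ha v := by
    rw [h.gForm_eq hL, h.gForm_eq hL, WithLp.ofLp_add, Matrix.add_vecMul,
      mem_loadingKernel.1 ha, zero_add]
  mem_of_map_eq_zero v hv := by
    rw [h.gForm_eq hL] at hv
    have h1 := (WithLp.toLp_eq_zero 2).1 hv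
    let C := crossCov (fun ω => (Z 0 ω).ofLp) (fun ω j => σ 0 ω j ^ 2) P
    -- Rank `p` equals the number of columns, so the kernel is trivial; the squares `(Λᵀ v)_j²` then
    -- vanish, and with them `Λᵀ v`.
    have hinj : Function.Injective C.mulVecLin := by
      rw [← LinearMap.ker_eq_bot, ← Submodule.finrank_eq_zero (R := ℝ)]
      have h2 := LinearMap.finrank_range_add_finrank_ker C.mulVecLin
      have h3 : Module.finrank ℝ (LinearMap.range C.mulVecLin) = p := h.cov_Z_sq 0
      rw [h3, Module.finrank_pi, Fintype.card_fin] at h2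
      omega
    have h4 := hinj (a₁ := fun j => (Matrix.vecMul v.ofLp Λ j) ^ 2) (a₂ := 0)
      (by simpa using h1)
    rw [mem_loadingKernel]
    ext j
    have h5 := congrFun h4 j
    simpa using h5

lemma Model.mem_Gamma0 [IsProbabilityMeasure P] (h : Model P ℱ Y Z Λ σ Om)
    (hL : ∀ t, MemLp (stacked Y Z t) 2 P) {γ : USphere k} :
    γ ∈ Gamma0 P Y Z ↔ (γ : E k) ∈ loadingKernel Λ := by
  rw [← (h.isQuadraticModulo hL).map_eq_zero_iff, ← theta0_eq_gForm hL]
  rfl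

lemma isLeast_phi (hk : 0 < k) {θ : USphere k → E m} (hθ : Continuous θ) :
    IsLeast (Set.range fun γ => ‖θ γ‖ ^ 2) (phi θ) := by
  have : Nonempty (Fin k) := ⟨⟨0, hk⟩⟩
  have : Nonempty (USphere k) := (NormedSpace.sphere_nonempty.2 zero_le_one).to_subtype
  obtain ⟨γ, -, hγ⟩ := isCompact_univ.exists_isMinOn Set.univ_nonempty
    (f := fun γ => ‖θ γ‖ ^ 2) (by fun_prop)
  have hl : IsLeast (Set.range fun γ => ‖θ γ‖ ^ 2) (‖θ γ‖ ^ 2) :=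
    ⟨⟨γ, rfl⟩, by rintro _ ⟨γ', rfl⟩; exact hγ trivial⟩
  rw [phi, iInf, hl.csInf_eq]
  exact hl

lemma continuous_theta0 [IsProbabilityMeasure P] (h : Model P ℱ Y Z Λ σ Om)
    (hL : ∀ t, MemLp (stacked Y Z t) 2 P) : Continuous (theta0 P Y Z) := by
  simp_rw [funext fun γ => theta0_eq_gForm (P := P) (Y := Y) (Z := Z) hL γ]
  exact (h.isQuadraticModulo hL).continuous.comp continuous_subtype_val

/-- The infimum in the null hypothesis is attained by compactness, so `Γ₀` is nonempty. -/
lemma Model.exists_mem_loadingKernel [IsProbabilityMeasure P] (h : Model P ℱ Y Z Λ σ Om)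
    (hL : ∀ t, MemLp (stacked Y Z t) 2 P) (hk : 0 < k) (hH0 : phi (theta0 P Y Z) = 0) :
    ∃ γ : USphere k, (γ : E k) ∈ loadingKernel Λ := by
  obtain ⟨γ, hγ⟩ := (isLeast_phi hk (continuous_theta0 h hL)).1
  refine ⟨γ, (h.mem_Gamma0 hL).1 ?_⟩
  rw [hH0] at hγ
  simpa [Gamma0] using hγ

/-- The centred product `(Z_t - μ_z)_i {(γᵀ Y_{t+1})² - c(γ)}`. -/
def centredProduct (P : Measure Ω) (Y : ℕ → Ω → E k) (Z : ℕ → Ω → E m) (γ : E k) (i : Fin m)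
    (t : ℕ) (ω : Ω) : ℝ :=
  (Z t ω i - ∫ ω', Z 0 ω' i ∂P) * ((inner ℝ γ (Y (t + 1) ω)) ^ 2 - c P Y γ)

lemma memLp_centredProduct [IsProbabilityMeasure P] (hL : ∀ t, MemLp (stacked Y Z t) 2 P)
    (γ : E k) (i : Fin m) (t : ℕ) : MemLp (centredProduct P Y Z γ i t) 2 P := by
  have h1 := (((memLp_inner_sq_mul hL t γ i).sub ((memLp_instrument hL t i).const_mul (c P Y γ))).sub
    ((memLp_inner_sq hL t γ).const_mul (∫ ω', Z 0 ω' i ∂P))).add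
    (memLp_const (μ := P) (p := 2) ((∫ ω', Z 0 ω' i ∂P) * c P Y γ))
  convert h1 using 1
  ext ω
  simp only [centredProduct, Pi.add_apply, Pi.sub_apply]
  ring

/-- For `γ` in the kernel the factors drop out of `γᵀ Y_{t+1}`: its conditional variance is the
constant `γᵀ Om γ = c(γ)`. -/
lemma Model.isMartingaleDifference_centredProduct [IsProbabilityMeasure P]
    (h : Model P ℱ Y Z Λ σ Om) (hL : ∀ t, MemLp (stacked Y Z t) 2 P) {γ : E k}
    (hγ : γ ∈ loadingKernel Λ) (i : Fin m) :
    IsMartingaleDifference (centredProduct P Y Z γ i) ℱ P := by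
  have hZm : ∀ t, StronglyMeasurable[ℱ t] (fun ω => Z t ω i - ∫ ω', Z 0 ω' i ∂P) := fun t =>
    (((EuclideanSpace.proj (𝕜 := ℝ) i).continuous.measurable.comp
      (h.adapted_Z t)).sub_const _).stronglyMeasurable
  have hconst : ∀ t ω, condVar Λ σ Om γ t ω = γ.ofLp ⬝ᵥ Om.mulVec γ.ofLp := by
    intro t ω
    simp [condVar, mem_loadingKernel.1 hγ]
  have hc : c P Y γ = γ.ofLp ⬝ᵥ Om.mulVec γ.ofLp := by
    rw [c, ← integral_condExp (ℱ.le 0), integral_congr_ae (h.condExp_inner_sq hL 0 γ)]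
    simp [hconst]
  refine ⟨fun t => ?_, fun t => ?_⟩
  · refine ((hZm t).mono (ℱ.mono t.le_succ)).mul ?_
    refine Measurable.stronglyMeasurable ?_
    have h1 : Continuous fun y : E k => (inner ℝ γ y) ^ 2 - c P Y γ := by fun_prop
    exact h1.measurable.comp (h.adapted_Y (t + 1))
  · have hq := memLp_inner_sq hL t γ
    have hqc : Integrable (fun ω => (inner ℝ γ (Y (t + 1) ω)) ^ 2 - c P Y γ) P :=
      (hq.integrable one_le_two).sub (integrable_const _)
    have h1 : P[fun ω => (inner ℝ γ (Y (t + 1) ω)) ^ 2 - c P Y γ | ℱ t] =ᵐ[P] 0 := by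
      refine (condExp_sub (hq.integrable one_le_two) (integrable_const _) _).trans ?_
      rw [condExp_const (ℱ.le t)]
      filter_upwards [h.condExp_inner_sq hL t γ] with ω hω
      simp [hω, hconst, hc]
    have h2 := condExp_mul_of_stronglyMeasurable_left (hZm t)
      ((memLp_centredProduct hL γ i t).integrable one_le_two) hqc
    refine EventuallyEq.trans h2 ?_
    filter_upwards [h1] with ω hω
    simp [hω]

end ModelConsequences

/-! ### The estimation error as a function of the normalized sums. -/

section EstimatorLimit

variable {Ω : Type*} {mΩ : MeasurableSpace Ω} {k m p : ℕ}

/-- The space of the stacked vectors. -/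
abbrev StackedSpace (k m : ℕ) : Type :=
  EuclideanSpace ℝ (Fin m ⊕ (Fin k × Fin k) ⊕ ((Fin k × Fin k) × Fin m))

lemma integral_mul_eq_sub_div_four {α : Type*} {mα : MeasurableSpace α} {μ : Measure α}
    {f g : α → ℝ} (hf : MemLp f 2 μ) (hg : MemLp g 2 μ) :
    ∫ x, f x * g x ∂μ =
      (∫ x, (f x + 1 * g x) ^ 2 ∂μ - ∫ x, (f x + (-1) * g x) ^ 2 ∂μ) / 4 := by
  have h : ∀ ε : ℝ, Integrable (fun x => (f x + ε * g x) ^ 2) μ := fun ε =>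
    (hf.add (hg.const_mul ε)).integrable_sq
  rw [← integral_sub (h 1) (h (-1)), ← integral_div]
  congr 1
  ext x
  ring

/-- The `i`-th coordinate of the second order expansion of the estimation error at `γ`, as a
function of the normalized sum `u` of the stacked vectors, where `r ^ 2` is `T^{-1/2}`. -/
def expansionCoord (P : Measure Ω) (Y : ℕ → Ω → E k) (Z : ℕ → Ω → E m) (x : StackedSpace k m × ℝ)
    (γ : E k) (i : Fin m) : ℝ :=
  ∑ a, (outer γ).vec a * x.1 (Sum.inr (Sum.inr (a, i)))
    - (∫ ω, Z 0 ω i ∂P) * ∑ a, (outer γ).vec a * x.1 (Sum.inr (Sum.inl a))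
    - c P Y γ * x.1 (Sum.inl i)
    - x.2 ^ 2 * (x.1 (Sum.inl i) * ∑ a, (outer γ).vec a * x.1 (Sum.inr (Sum.inl a)))

lemma continuous_expansionCoord {P : Measure Ω} [IsProbabilityMeasure P] {Y : ℕ → Ω → E k}
    {Z : ℕ → Ω → E m} (hL : ∀ t, MemLp (stacked Y Z t) 2 P) (i : Fin m) :
    Continuous fun z : (StackedSpace k m × ℝ) × USphere k =>
      expansionCoord P Y Z z.1 (z.2 : E k) i := by
  have h1 : ∀ a : Fin k × Fin k, Continuous fun z : (StackedSpace k m × ℝ) × USphere k =>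
      (outer (z.2 : E k)).vec a := fun a =>
    (vec_outer_continuous a).comp (continuous_subtype_val.comp continuous_snd)
  unfold expansionCoord
  simp_rw [c_eq_sum hL]
  fun_prop

/-- The second order expansion of the estimation error, as a continuous function with values in the
path space. -/
def expansion (P : Measure Ω) [IsProbabilityMeasure P] (Y : ℕ → Ω → E k) (Z : ℕ → Ω → E m)
    (hL : ∀ t, MemLp (stacked Y Z t) 2 P) : C(StackedSpace k m × ℝ, PathSpace k m) :=
  ContinuousMap.curry ⟨fun z => WithLp.toLp 2 fun i => expansionCoord P Y Z z.1 (z.2 : E k) i,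
    (PiLp.continuous_toLp 2 _).comp (continuous_pi (continuous_expansionCoord hL))⟩

variable {P : Measure Ω} [IsProbabilityMeasure P] {Y : ℕ → Ω → E k} {Z : ℕ → Ω → E m}

lemma expansion_apply (hL : ∀ t, MemLp (stacked Y Z t) 2 P) (x : StackedSpace k m × ℝ)
    (γ : USphere k) (i : Fin m) :
    expansion P Y Z hL x γ i = expansionCoord P Y Z x (γ : E k) i := rfl

/-- The linear part of the expansion. -/
def expansionLinear (P : Measure Ω) [IsProbabilityMeasure P] (Y : ℕ → Ω → E k) (Z : ℕ → Ω → E m)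
    (hL : ∀ t, MemLp (stacked Y Z t) 2 P) : StackedSpace k m →L[ℝ] PathSpace k m where
  toFun u := expansion P Y Z hL (u, 0)
  map_add' u v := by
    ext γ i
    simp only [ContinuousMap.add_apply, PiLp.add_apply, expansion_apply, expansionCoord, mul_add,
      Finset.sum_add_distrib]
    ring
  map_smul' r u := by
    ext γ i
    simp only [ContinuousMap.smul_apply, PiLp.smul_apply, expansion_apply, expansionCoord,
      smul_eq_mul, RingHom.id_apply, mul_left_comm _ r, ← Finset.mul_sum]
    ring
  cont := (expansion P Y Z hL).continuous.comp (by fun_prop)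

lemma expansionLinear_apply (hL : ∀ t, MemLp (stacked Y Z t) 2 P) (u : StackedSpace k m) :
    expansionLinear P Y Z hL u = expansion P Y Z hL (u, 0) := rfl

/-- The normalized sum of the centred stacked vectors. -/
def normalizedSum (P : Measure Ω) (Y : ℕ → Ω → E k) (Z : ℕ → Ω → E m) (T : ℕ) (ω : Ω) :
    StackedSpace k m :=
  (Real.sqrt T)⁻¹ • ∑ t ∈ Finset.range T, (stacked Y Z t ω - ∫ ω', stacked Y Z t ω' ∂P)

variable {ℱ : Filtration ℕ mΩ} {Λ : Matrix (Fin k) (Fin p) ℝ} {σ : ℕ → Ω → Fin p → ℝ}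
  {Om : Matrix (Fin k) (Fin k) ℝ}

omit [IsProbabilityMeasure P] in
lemma Model.integral_stacked (h : Model P ℱ Y Z Λ σ Om) (t : ℕ) :
    ∫ ω, stacked Y Z t ω ∂P = ∫ ω, stacked Y Z 0 ω ∂P := by
  let f : (E k × E m) × (E k × E m) → StackedSpace k m := fun x =>
    WithLp.toLp 2 <| Sum.elim (fun i => x.1.2 i) <| Sum.elim (fun a => (outer x.2.1).vec a)
      (fun a => (outer x.2.1).vec a.1 * x.1.2 a.2)
  have h1 : ∀ a : Fin k × Fin k, Continuous fun x : (E k × E m) × (E k × E m) =>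
      (outer x.2.1).vec a := fun a => (vec_outer_continuous a).comp (by fun_prop)
  have hf : Continuous f := by
    refine (PiLp.continuous_toLp 2 _).comp (continuous_pi ?_)
    rintro (i | a | a)
    · simp only [Sum.elim_inl]
      fun_prop
    · exact h1 a
    · simp only [Sum.elim_inr]
      have := h1 a.1
      fun_prop
  exact ((h.stationary_pair t).comp hf.measurable).integral_eq

lemma Model.normalizedSum_apply (h : Model P ℱ Y Z Λ σ Om)
    (hL : ∀ t, MemLp (stacked Y Z t) 2 P) (T : ℕ) (ω : Ω)
    (s : Fin m ⊕ (Fin k × Fin k) ⊕ ((Fin k × Fin k) × Fin m)) :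
    normalizedSum P Y Z T ω s = (√T)⁻¹ *
      ∑ t ∈ Finset.range T, (stacked Y Z t ω s - ∫ ω', stacked Y Z 0 ω' s ∂P) := by
  rw [normalizedSum, PiLp.smul_apply, WithLp.ofLp_sum, Finset.sum_apply, smul_eq_mul]
  congr 1
  refine Finset.sum_congr rfl fun t _ => ?_
  rw [h.integral_stacked, PiLp.sub_apply,
    eval_integral_piLp fun s => ((hL 0).eval_piLp s).integrable one_le_two]

lemma Model.normalizedSum_instrument (h : Model P ℱ Y Z Λ σ Om)
    (hL : ∀ t, MemLp (stacked Y Z t) 2 P) (T : ℕ) (ω : Ω) (i : Fin m) :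
    normalizedSum P Y Z T ω (Sum.inl i) = (√T)⁻¹ *
      ∑ t ∈ Finset.range T, (Z t ω i - ∫ ω', Z 0 ω' i ∂P) :=
  h.normalizedSum_apply hL T ω (Sum.inl i)

lemma Model.sum_mul_normalizedSum_vec (h : Model P ℱ Y Z Λ σ Om)
    (hL : ∀ t, MemLp (stacked Y Z t) 2 P) (T : ℕ) (ω : Ω) (γ : E k) :
    ∑ a, (outer γ).vec a * normalizedSum P Y Z T ω (Sum.inr (Sum.inl a)) = (√T)⁻¹ *
      ∑ t ∈ Finset.range T, ((inner ℝ γ (Y (t + 1) ω)) ^ 2 - c P Y γ) := by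
  simp_rw [h.normalizedSum_apply hL, mul_left_comm _ (√T)⁻¹, ← Finset.mul_sum, Finset.mul_sum]
  rw [Finset.sum_comm]
  simp_rw [← Finset.mul_sum]
  congr 1
  refine Finset.sum_congr rfl fun t _ => ?_
  rw [c_eq_sum hL, inner_sq_eq_sum_vec, ← Finset.sum_sub_distrib]
  refine Finset.sum_congr rfl fun a _ => ?_
  rw [mul_sub]
  rfl

lemma Model.sum_mul_normalizedSum_mul (h : Model P ℱ Y Z Λ σ Om)
    (hL : ∀ t, MemLp (stacked Y Z t) 2 P) (T : ℕ) (ω : Ω) (γ : E k) (i : Fin m) :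
    ∑ a, (outer γ).vec a * normalizedSum P Y Z T ω (Sum.inr (Sum.inr (a, i))) = (√T)⁻¹ *
      ∑ t ∈ Finset.range T, ((inner ℝ γ (Y (t + 1) ω)) ^ 2 * Z t ω i -
        ∫ ω', (inner ℝ γ (Y 1 ω')) ^ 2 * Z 0 ω' i ∂P) := by
  have h1 : ∫ ω', (inner ℝ γ (Y 1 ω')) ^ 2 * Z 0 ω' i ∂P =
      ∑ a, (outer γ).vec a * ∫ ω', (outer (Y 1 ω')).vec a * Z 0 ω' i ∂P := by
    simp_rw [inner_sq_eq_sum_vec, Finset.sum_mul, mul_assoc]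
    rw [integral_finsetSum _ fun a _ =>
      (((memLp_vec_outer_mul hL 0 a i).integrable one_le_two).const_mul _)]
    simp_rw [zero_add, integral_const_mul]
  simp_rw [h.normalizedSum_apply hL, mul_left_comm _ (√T)⁻¹, ← Finset.mul_sum, Finset.mul_sum]
  rw [Finset.sum_comm]
  simp_rw [← Finset.mul_sum]
  congr 1
  refine Finset.sum_congr rfl fun t _ => ?_
  rw [h1, inner_sq_eq_sum_vec, Finset.sum_mul, ← Finset.sum_sub_distrib]
  refine Finset.sum_congr rfl fun a _ => ?_
  rw [mul_sub, mul_assoc]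
  rfl

lemma gForm_apply_eq_sub (hL : ∀ t, MemLp (stacked Y Z t) 2 P) (v : E k) (i : Fin m) :
    gForm P Y Z v i =
      ∫ ω, (inner ℝ v (Y 1 ω)) ^ 2 * Z 0 ω i ∂P - (∫ ω, Z 0 ω i ∂P) * c P Y v := by
  rw [gForm_apply hL, ← integral_mul_const, ← integral_sub]
  · congr 1
    ext ω
    ring
  · exact (memLp_inner_sq_mul hL 0 v i).integrable one_le_two
  · exact ((memLp_instrument hL 0 i).integrable one_le_two).mul_const _

lemma thetaHat_apply (T : ℕ) (ω : Ω) (γ : USphere k) (i : Fin m) :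
    thetaHat Y Z T ω γ i = (T : ℝ)⁻¹ *
      (∑ t ∈ Finset.range T, (inner ℝ (γ : E k) (Y (t + 1) ω)) ^ 2 * Z t ω i -
        cHat Y T ω γ * ∑ t ∈ Finset.range T, Z t ω i) := by
  change ((T : ℝ)⁻¹ • ∑ t ∈ Finset.range T,
    ((inner ℝ (γ : E k) (Y (t + 1) ω)) ^ 2 - cHat Y T ω γ) • Z t ω) i = _
  rw [PiLp.smul_apply, WithLp.ofLp_sum, Finset.sum_apply, smul_eq_mul,
    Finset.mul_sum (Finset.range T) _ (cHat Y T ω γ), ← Finset.sum_sub_distrib]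
  congr 1
  refine Finset.sum_congr rfl fun t _ => ?_
  rw [PiLp.smul_apply, smul_eq_mul, sub_mul]

/-- `θ₀` as an element of the path space. -/
def Model.thetaPath (h : Model P ℱ Y Z Λ σ Om) (hL : ∀ t, MemLp (stacked Y Z t) 2 P) :
    PathSpace k m :=
  ⟨theta0 P Y Z, continuous_theta0 h hL⟩

lemma Model.thetaPath_apply (h : Model P ℱ Y Z Λ σ Om) (hL : ∀ t, MemLp (stacked Y Z t) 2 P)
    (γ : USphere k) : h.thetaPath hL γ = gForm P Y Z γ :=
  theta0_eq_gForm hL γ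

/-- Exact, with no remainder: writing the product of two sample means around their expectations
leaves two linear terms and a product of deviations, and that product carries the factor `T^{-1/2} =
r²`. At `T = 0` both sides vanish. -/
lemma Model.error_eq_expansion (h : Model P ℱ Y Z Λ σ Om)
    (hL : ∀ t, MemLp (stacked Y Z t) 2 P) (T : ℕ) (ω : Ω) :
    √T • (thetaHat Y Z T ω - h.thetaPath hL) =
      expansion P Y Z hL (normalizedSum P Y Z T ω, √(√T)⁻¹) := by
  ext γ i
  rw [ContinuousMap.smul_apply, PiLp.smul_apply, smul_eq_mul, ContinuousMap.sub_apply,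
    PiLp.sub_apply, h.thetaPath_apply, gForm_apply_eq_sub hL, thetaHat_apply, expansion_apply,
    expansionCoord]
  simp only
  rw [h.sum_mul_normalizedSum_mul hL, h.sum_mul_normalizedSum_vec hL,
    h.normalizedSum_instrument hL, Real.sq_sqrt (by positivity), cHat]
  simp only [Finset.sum_sub_distrib, Finset.sum_const, Finset.card_range, nsmul_eq_mul]
  rcases Nat.eq_zero_or_pos T with rfl | hT
  · simp
  · have hs : 0 < √(T : ℝ) := Real.sqrt_pos.2 (by exact_mod_cast hT)
    have hTs : (T : ℝ) = √T ^ 2 := (Real.sq_sqrt (by positivity)).symm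
    generalize √(T : ℝ) = s at hs hTs
    rw [hTs]
    field_simp
    ring

/-- On the kernel `θ₀(γ) = 0`, so `E[(γᵀ Y_1)² Z_0] = c(γ) μ_z` and the centring constants combine
into a product of centred factors. -/
lemma Model.expansionLinear_normalizedSum (h : Model P ℱ Y Z Λ σ Om)
    (hL : ∀ t, MemLp (stacked Y Z t) 2 P) {γ : USphere k} (hγ : (γ : E k) ∈ loadingKernel Λ)
    (i : Fin m) (T : ℕ) (ω : Ω) :
    expansionLinear P Y Z hL (normalizedSum P Y Z T ω) γ i =
      (√T)⁻¹ * ∑ t ∈ Finset.range T, centredProduct P Y Z γ i t ω := by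
  have h0 : gForm P Y Z γ i = 0 := by
    rw [(h.isQuadraticModulo hL).map_eq_zero_iff.2 hγ]
    rfl
  rw [gForm_apply_eq_sub hL, sub_eq_zero] at h0
  rw [expansionLinear_apply, expansion_apply, expansionCoord]
  simp only
  rw [h.sum_mul_normalizedSum_mul hL, h.sum_mul_normalizedSum_vec hL,
    h.normalizedSum_instrument hL, h0]
  rw [mul_left_comm _ (√(T : ℝ))⁻¹, mul_left_comm _ (√(T : ℝ))⁻¹]
  rw [zero_pow two_ne_zero, zero_mul, sub_zero, ← mul_sub, ← mul_sub, Finset.mul_sum,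
    Finset.mul_sum, ← Finset.sum_sub_distrib, ← Finset.sum_sub_distrib]
  congr 1
  refine Finset.sum_congr rfl fun t _ => ?_
  simp only [centredProduct]
  ring

omit [IsProbabilityMeasure P] in
lemma Model.identDistrib_centredProduct_add (h : Model P ℱ Y Z Λ σ Om) (γ₁ γ₂ : E k) (i j : Fin m)
    (ε : ℝ) (t : ℕ) :
    IdentDistrib (fun ω => centredProduct P Y Z γ₁ i t ω + ε * centredProduct P Y Z γ₂ j t ω)
      (fun ω => centredProduct P Y Z γ₁ i 0 ω + ε * centredProduct P Y Z γ₂ j 0 ω) P P := by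
  let f : (E k × E m) × (E k × E m) → ℝ := fun x =>
    (x.1.2 i - ∫ ω', Z 0 ω' i ∂P) * ((inner ℝ γ₁ x.2.1) ^ 2 - c P Y γ₁) +
      ε * ((x.1.2 j - ∫ ω', Z 0 ω' j ∂P) * ((inner ℝ γ₂ x.2.1) ^ 2 - c P Y γ₂))
  have hf : Continuous f := by fun_prop
  exact (h.stationary_pair t).comp hf.measurable

/-- Combinations of two coordinates are again martingale difference sums; `ε = ±1` supplies the two
squares needed for polarization. -/
lemma Model.integral_expansionLinear_add_sq (h : Model P ℱ Y Z Λ σ Om)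
    (hL : ∀ t, MemLp (stacked Y Z t) 2 P) {N : Measure (StackedSpace k m)} [IsGaussian N]
    (hN : TendstoInDistribution (normalizedSum P Y Z) atTop (fun x => x) (fun _ => P) N)
    {γ₁ γ₂ : USphere k} (hγ₁ : (γ₁ : E k) ∈ loadingKernel Λ) (hγ₂ : (γ₂ : E k) ∈ loadingKernel Λ)
    (i j : Fin m) (ε : ℝ) :
    ∫ u, (expansionLinear P Y Z hL u γ₁ i + ε * expansionLinear P Y Z hL u γ₂ j) ^ 2 ∂N =
      ∫ ω, (centredProduct P Y Z γ₁ i 0 ω + ε * centredProduct P Y Z γ₂ j 0 ω) ^ 2 ∂P := by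
  let ℓ : StackedSpace k m →L[ℝ] ℝ :=
    (EuclideanSpace.proj i ∘L ContinuousMap.evalCLM ℝ γ₁ +
      ε • (EuclideanSpace.proj j ∘L ContinuousMap.evalCLM ℝ γ₂)) ∘L expansionLinear P Y Z hL
  have hℓ : ∀ u, ℓ u = expansionLinear P Y Z hL u γ₁ i + ε * expansionLinear P Y Z hL u γ₂ j :=
    fun u => rfl
  have hmd : IsMartingaleDifference
      (fun t ω => centredProduct P Y Z γ₁ i t ω + ε * centredProduct P Y Z γ₂ j t ω) ℱ P := by
    have h1 := h.isMartingaleDifference_centredProduct hL hγ₁ i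
    have h2 := h.isMartingaleDifference_centredProduct hL hγ₂ j
    refine ⟨fun t => (h1.stronglyMeasurable t).add ((h2.stronglyMeasurable t).const_mul ε),
      fun t => ?_⟩
    have i1 := (memLp_centredProduct hL (γ₁ : E k) i t).integrable one_le_two
    have i2 := (memLp_centredProduct hL (γ₂ : E k) j t).integrable one_le_two
    refine (condExp_add i1 (i2.smul ε) (ℱ t)).trans ?_
    have h3 : P[ε • centredProduct P Y Z γ₂ j t | ℱ t] =ᵐ[P]
      ε • P[centredProduct P Y Z γ₂ j t | ℱ t] := condExp_smul _ _ _
    filter_upwards [h1.condExp_eq_zero t, h2.condExp_eq_zero t, h3] with ω h4 h5 h6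
    simp [h4, h5, h6]
  simp_rw [← hℓ]
  refine hmd.integral_sq_limit ?_ (h.identDistrib_centredProduct_add _ _ i j ε)
    (ℓ.comp_memLp' IsGaussian.memLp_two_fun_id) ?_
  · exact (memLp_centredProduct hL (γ₁ : E k) i 0).add
      ((memLp_centredProduct hL (γ₂ : E k) j 0).const_mul ε)
  · have h1 := hN.continuous_comp ℓ.continuous
    convert! h1 using 2 with T
    ext ω
    rw [Function.comp_apply, hℓ, h.expansionLinear_normalizedSum hL hγ₁,
      h.expansionLinear_normalizedSum hL hγ₂, mul_left_comm, ← mul_add,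
      Finset.mul_sum _ _ ε, ← Finset.sum_add_distrib]

lemma Model.integral_expansionLinear_mul (h : Model P ℱ Y Z Λ σ Om)
    (hL : ∀ t, MemLp (stacked Y Z t) 2 P) {N : Measure (StackedSpace k m)} [IsGaussian N]
    (hN : TendstoInDistribution (normalizedSum P Y Z) atTop (fun x => x) (fun _ => P) N)
    {γ₁ γ₂ : USphere k} (hγ₁ : (γ₁ : E k) ∈ loadingKernel Λ) (hγ₂ : (γ₂ : E k) ∈ loadingKernel Λ)
    (i j : Fin m) :
    ∫ u, expansionLinear P Y Z hL u γ₁ i * expansionLinear P Y Z hL u γ₂ j ∂N =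
      covFunctional P Y Z γ₁ γ₂ i j := by
  have hl : ∀ (γ : USphere k) (i : Fin m),
      MemLp (fun u => expansionLinear P Y Z hL u γ i) 2 N := fun γ i =>
    (EuclideanSpace.proj i ∘L ContinuousMap.evalCLM ℝ γ ∘L expansionLinear P Y Z hL).comp_memLp'
      IsGaussian.memLp_two_fun_id
  rw [integral_mul_eq_sub_div_four (hl γ₁ i) (hl γ₂ j), h.integral_expansionLinear_add_sq hL hN hγ₁ hγ₂,
    h.integral_expansionLinear_add_sq hL hN hγ₁ hγ₂]
  have h1 : covFunctional P Y Z γ₁ γ₂ i j =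
      ∫ ω, centredProduct P Y Z γ₁ i 0 ω * centredProduct P Y Z γ₂ j 0 ω ∂P := by
    unfold covFunctional centredProduct
    congr 1
    ext ω
    rw [zero_add]
    ring
  have hc1 := memLp_centredProduct hL (γ₁ : E k) i 0
  have hc2 := memLp_centredProduct hL (γ₂ : E k) j 0
  rw [h1, integral_mul_eq_sub_div_four hc1 hc2]

end EstimatorLimit

/-! ### Convergence of the statistic and of the estimator. -/

section LimitLaw

variable {Ω : Type*} {mΩ : MeasurableSpace Ω} {k m p : ℕ} {P : Measure Ω} [IsProbabilityMeasure P]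
  {Y : ℕ → Ω → E k} {Z : ℕ → Ω → E m} {ℱ : Filtration ℕ mΩ} {Λ : Matrix (Fin k) (Fin p) ℝ}
  {σ : ℕ → Ω → Fin p → ℝ} {Om : Matrix (Fin k) (Fin k) ℝ}

lemma Model.isLeast_innerMin (h : Model P ℱ Y Z Λ σ Om)
    (hL : ∀ t, MemLp (stacked Y Z t) 2 P) (x : E m) :
    IsLeast (Set.range (shifted P Y Z x)) (innerMin P Y Z x) := by
  obtain ⟨v, hv⟩ := exists_isMin_norm_add (h.isQuadraticModulo hL) x
  have hl : IsLeast (Set.range (shifted P Y Z x)) (shifted P Y Z x v) :=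
    ⟨⟨v, rfl⟩, by rintro _ ⟨w, rfl⟩; exact hv w⟩
  rw [innerMin, iInf, hl.csInf_eq]
  exact hl

lemma Model.isLeast_fiberMin (h : Model P ℱ Y Z Λ σ Om)
    (hL : ∀ t, MemLp (stacked Y Z t) 2 P) (hN : ∃ γ : USphere k, (γ : E k) ∈ loadingKernel Λ)
    (x : PathSpace k m) :
    IsLeast ((fun γ₀ => innerMin P Y Z (x γ₀)) '' Gamma0 P Y Z)
      (fiberMin (loadingKernel Λ) (gForm P Y Z) (0, x)) := by
  obtain ⟨γ, hγ, v, hval, hmin⟩ := exists_isMin_zero_fiber (h.isQuadraticModulo hL) hN x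
  rw [← hval]
  refine ⟨⟨γ, (h.mem_Gamma0 hL).2 hγ, ?_⟩, ?_⟩
  · refine (h.isLeast_innerMin hL (x γ)).unique ⟨⟨v, rfl⟩, ?_⟩
    rintro _ ⟨w, rfl⟩
    exact hmin γ hγ w
  · rintro _ ⟨γ', hγ', rfl⟩
    obtain ⟨w, hw⟩ := (h.isLeast_innerMin hL (x γ')).1
    simp only [← hw]
    exact hmin γ' ((h.mem_Gamma0 hL).1 hγ') w

lemma Model.limitFunctional_eq (h : Model P ℱ Y Z Λ σ Om)
    (hL : ∀ t, MemLp (stacked Y Z t) 2 P) (hN : ∃ γ : USphere k, (γ : E k) ∈ loadingKernel Λ)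
    (x : PathSpace k m) :
    limitFunctional P Y Z x = fiberMin (loadingKernel Λ) (gForm P Y Z) (0, x) := by
  rw [← (h.isLeast_fiberMin hL hN x).csInf_eq, Set.image_eq_range]
  rfl

/-- With `r = T^{-1/4}` one has `r⁻² = √T`, so `h γ + r⁻² Q γ` collapses to `√T θ̂_T(γ)`. -/
lemma Model.mul_phi_eq (h : Model P ℱ Y Z Λ σ Om) (hL : ∀ t, MemLp (stacked Y Z t) 2 P)
    (hN : ∃ γ : USphere k, (γ : E k) ∈ loadingKernel Λ) (T : ℕ) (ω : Ω) :
    (T : ℝ) * phi (thetaHat Y Z T ω) = fiberMin (loadingKernel Λ) (gForm P Y Z)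
      (√(√T)⁻¹, √T • (thetaHat Y Z T ω - h.thetaPath hL)) := by
  have hQ := h.isQuadraticModulo hL
  rcases Nat.eq_zero_or_pos T with rfl | hT
  -- At `T = 0` the error path is zero, and the feasible pair `(γ, 0)` shows that the minimum is
  -- zero too.
  · obtain ⟨γ, hγ⟩ := hN
    have h0 : √((0 : ℕ) : ℝ) • (thetaHat Y Z 0 ω - h.thetaPath hL) = 0 := by
      ext γ i
      simp only [ContinuousMap.smul_apply, Nat.cast_zero, Real.sqrt_zero, PiLp.smul_apply,
        smul_eq_mul, zero_mul]
      rfl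
    rw [h0, Nat.cast_zero, zero_mul]
    refine le_antisymm (Real.sInf_nonneg ?_) ?_
    · rintro _ ⟨y, -, rfl⟩
      positivity
    · refine (fiberMin_le _ _ _ 0 (mk_zero_mem_scaledFiber hγ _)).trans_eq ?_
      rw [hQ.map_zero, add_zero, ContinuousMap.zero_apply, norm_zero, zero_pow two_ne_zero]
  · have hTr : (0 : ℝ) < T := by exact_mod_cast hT
    have hs : 0 < √(T : ℝ) := Real.sqrt_pos.2 hTr
    rw [fiberMin_of_ne_zero hQ (Real.sqrt_pos.2 (inv_pos.2 hs)).ne', Real.sq_sqrt (by positivity),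
      inv_inv, phi, Real.mul_iInf_of_nonneg hTr.le]
    congr 1
    ext γ
    rw [ContinuousMap.smul_apply, ContinuousMap.sub_apply, h.thetaPath_apply, ← smul_add,
      sub_add_cancel, norm_smul, mul_pow, Real.norm_of_nonneg hs.le, Real.sq_sqrt hTr.le]

/-- A limit in distribution may be transported along a measurable map. -/
lemma tendstoInDistribution_map {ι S S' R : Type*} {l : Filter ι} [MeasurableSpace S]
    [MeasurableSpace S'] [TopologicalSpace R] [MeasurableSpace R] [OpensMeasurableSpace R]
    {X : ι → Ω → R} {N : Measure S} [IsProbabilityMeasure N] {L : S → S'} (hL : Measurable L)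
    {f : S' → R} (hf : Measurable f) [IsProbabilityMeasure (N.map L)]
    (h : TendstoInDistribution X l (fun s => f (L s)) (fun _ => P) N) :
    TendstoInDistribution X l f (fun _ => P) (N.map L) where
  forall_aemeasurable := h.forall_aemeasurable
  aemeasurable_limit := hf.aemeasurable
  tendsto := by
    have h1 := h.tendsto
    simp only [Measure.map_map hf hL]
    exact h1

/-- The scale `T^{-1/4}` is deterministic and tends to zero, so it joins the normalized sum by
Slutsky's theorem. -/
lemma tendstoInDistribution_normalizedSum_prodMk
    {N : Measure (StackedSpace k m)} [IsProbabilityMeasure N]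
    (hN : TendstoInDistribution (normalizedSum P Y Z) atTop (fun x => x) (fun _ => P) N) :
    TendstoInDistribution (fun (T : ℕ) ω => (normalizedSum P Y Z T ω, √(√(T : ℝ))⁻¹)) atTop
      (fun u => (u, (0 : ℝ))) (fun _ => P) N := by
  have hr : Tendsto (fun T : ℕ => √(√(T : ℝ))⁻¹) atTop (𝓝 0) := by
    have h1 : Tendsto (fun T : ℕ => √(T : ℝ)) atTop atTop :=
      Real.tendsto_sqrt_atTop.comp tendsto_natCast_atTop_atTop
    have h2 := (Real.continuous_sqrt.tendsto 0).comp (tendsto_inv_atTop_zero.comp h1)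
    rwa [Real.sqrt_zero] at h2
  refine hN.prodMk_of_tendstoInMeasure_const _ _ _ ?_ fun _ => aemeasurable_const
  exact tendstoInMeasure_of_tendsto_ae (fun _ => aestronglyMeasurable_const)
    (ae_of_all _ fun _ => hr)

lemma Model.isEstimatorLimit (h : Model P ℱ Y Z Λ σ Om) (hL : ∀ t, MemLp (stacked Y Z t) 2 P)
    {N : Measure (StackedSpace k m)} [IsGaussian N] (hN0 : ∫ x, x ∂N = 0)
    (hN : TendstoInDistribution (normalizedSum P Y Z) atTop (fun x => x) (fun _ => P) N)
    [IsProbabilityMeasure (N.map (expansionLinear P Y Z hL))] :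
    IsEstimatorLimit P Y Z (N.map (expansionLinear P Y Z hL)) := by
  have hLm : Measurable (expansionLinear P Y Z hL) := (expansionLinear P Y Z hL).continuous.measurable
  have hcoord : ∀ (γ : USphere k) (i : Fin m), Continuous fun x : PathSpace k m => x γ i :=
    fun γ i => by fun_prop
  refine ⟨⟨fun I => ?_⟩, fun γ i => ?_, fun γ₁ hγ₁ γ₂ hγ₂ i j => ?_, h.thetaPath hL,
    fun γ => rfl, ?_⟩
  · let A : PathSpace k m →L[ℝ] (I → E m) :=
      ContinuousLinearMap.pi fun γ : I => ContinuousMap.evalCLM ℝ (γ : USphere k)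
    exact (IsGaussian.hasGaussianLaw_id
      (μ := N.map (expansionLinear P Y Z hL))).map_fun A
  · rw [integral_map hLm.aemeasurable (hcoord γ i).aestronglyMeasurable]
    let ℓ : StackedSpace k m →L[ℝ] ℝ :=
      EuclideanSpace.proj i ∘L ContinuousMap.evalCLM ℝ γ ∘L expansionLinear P Y Z hL
    have h1 := ℓ.integral_comp_comm (μ := N) (φ := fun x => x) IsGaussian.integrable_id
    rw [hN0, map_zero] at h1
    exact h1
  · have h1 : Continuous fun x : PathSpace k m => x γ₁ i * x γ₂ j :=
      (hcoord γ₁ i).mul (hcoord γ₂ j)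
    rw [integral_map hLm.aemeasurable h1.aestronglyMeasurable]
    exact h.integral_expansionLinear_mul hL hN ((h.mem_Gamma0 hL).1 hγ₁)
      ((h.mem_Gamma0 hL).1 hγ₂) i j
  -- At `r = 0` the expansion reduces to its linear part, whose law under `N` is the limit.
  · refine tendstoInDistribution_map hLm measurable_id ?_
    simp_rw [h.error_eq_expansion hL]
    exact (tendstoInDistribution_normalizedSum_prodMk hN).continuous_comp
      (expansion P Y Z hL).continuous

lemma Model.tendstoInDistribution_mul_phi (h : Model P ℱ Y Z Λ σ Om)
    (hL : ∀ t, MemLp (stacked Y Z t) 2 P) (hK : ∃ γ : USphere k, (γ : E k) ∈ loadingKernel Λ)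
    {N : Measure (StackedSpace k m)} [IsGaussian N]
    (hN : TendstoInDistribution (normalizedSum P Y Z) atTop (fun x => x) (fun _ => P) N)
    [IsProbabilityMeasure (N.map (expansionLinear P Y Z hL))] :
    TendstoInDistribution (fun (T : ℕ) ω => (T : ℝ) * phi (thetaHat Y Z T ω)) atTop
      (limitFunctional P Y Z) (fun _ => P) (N.map (expansionLinear P Y Z hL)) := by
  have hLm : Measurable (expansionLinear P Y Z hL) := (expansionLinear P Y Z hL).continuous.measurable
  have hfc := continuous_fiberMin (h.isQuadraticModulo hL) hK
  have hlim : limitFunctional P Y Z =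
      fun x => fiberMin (loadingKernel Λ) (gForm P Y Z) (0, x) :=
    funext (h.limitFunctional_eq hL hK)
  rw [hlim]
  refine tendstoInDistribution_map hLm
    (f := fun x => fiberMin (loadingKernel Λ) (gForm P Y Z) (0, x))
    (hfc.comp (Continuous.prodMk_right 0)).measurable ?_
  simp_rw [h.mul_phi_eq hL hK, h.error_eq_expansion hL]
  exact (tendstoInDistribution_normalizedSum_prodMk hN).continuous_comp
    (g := fun y : StackedSpace k m × ℝ =>
      fiberMin (loadingKernel Λ) (gForm P Y Z) (y.2, expansion P Y Z hL y))
    (hfc.comp (continuous_snd.prodMk (expansion P Y Z hL).continuous))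

end LimitLaw

end CommonCH

end

/-- Under the null hypothesis `φ(θ₀) = 0`, the statistic `T · min_γ ‖θ̂_T(γ)‖²` converges in law to
`min_{γ₀ ∈ Γ₀} min_v ‖𝔾(γ₀) + G vec(v vᵀ)‖²`, where `𝔾` (with law `ν`) is the limit of
`√T (θ̂_T - θ₀)`; all the infima involved are attained. -/
theorem proposition4p1 {Ω : Type*} {mΩ : MeasurableSpace Ω} (P : Measure Ω)
    [IsProbabilityMeasure P] {k m p : ℕ} (hk : 0 < k) (ℱ : Filtration ℕ mΩ)
    (Y : ℕ → Ω → CommonCH.E k) (Z : ℕ → Ω → CommonCH.E m)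
    (Λ : Matrix (Fin k) (Fin p) ℝ) (σ : ℕ → Ω → Fin p → ℝ) (Om : Matrix (Fin k) (Fin k) ℝ)
    (hmodel : CommonCH.Model P ℱ Y Z Λ σ Om)
    (hCLT : CommonCH.FulfilsCLT (CommonCH.stacked Y Z) P)
    (hH0 : CommonCH.phi (CommonCH.theta0 P Y Z) = 0) :
    (∀ (T : ℕ) (ω : Ω), IsLeast (Set.range fun γ => ‖CommonCH.thetaHat Y Z T ω γ‖ ^ 2)
      (CommonCH.phi (CommonCH.thetaHat Y Z T ω))) ∧
    (∀ x : CommonCH.E m, IsLeast (Set.range (CommonCH.shifted P Y Z x))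
      (CommonCH.innerMin P Y Z x)) ∧
    (∀ h : CommonCH.PathSpace k m,
      IsLeast ((fun γ₀ => CommonCH.innerMin P Y Z (h γ₀)) '' CommonCH.Gamma0 P Y Z)
        (CommonCH.limitFunctional P Y Z h)) ∧
    ∃ (ν : Measure (CommonCH.PathSpace k m)) (_ : IsProbabilityMeasure ν),
      CommonCH.IsEstimatorLimit P Y Z ν ∧
      TendstoInDistribution
        (fun (T : ℕ) ω => (T : ℝ) * CommonCH.phi (CommonCH.thetaHat Y Z T ω))
        atTop (CommonCH.limitFunctional P Y Z) (fun _ => P) ν := by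
  obtain ⟨hL, N, hNg, hN0, hN⟩ := hCLT
  have hK := hmodel.exists_mem_loadingKernel hL hk hH0
  have hν : IsProbabilityMeasure (N.map (CommonCH.expansionLinear P Y Z hL)) :=
    Measure.isProbabilityMeasure_map
      (CommonCH.expansionLinear P Y Z hL).continuous.measurable.aemeasurable
  refine ⟨fun T ω => CommonCH.isLeast_phi hk (CommonCH.thetaHat Y Z T ω).continuous,
    hmodel.isLeast_innerMin hL, fun x => ?_, N.map (CommonCH.expansionLinear P Y Z hL), hν,
    hmodel.isEstimatorLimit hL hN0 hN, hmodel.tendstoInDistribution_mul_phi hL hK hN⟩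
  rw [hmodel.limitFunctional_eq hL hK]
  exact hmodel.isLeast_fiberMin hL hK x
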